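/- **Setting.** Fix a many-sorted signature whose sorts are $\mathsf{Bool}$ and one uninterpreted sort $\mathsf S$, with constants $\mathsf{true},\mathsf{false}$ of sort $\mathsf{Bool}$ and arbitrary sorted function symbols. Interpretations have non-empty domains and interpret $\mathsf{Bool}$ as the two-element set of the (distinct) values of $\mathsf{true}$ and $\mathsf{false}$. Extend the signature with $\mathsf{Bool}$-constants $\mathsf{card}_{\mathsf S,k}$ ($k>0$ an integer). EUF is the theory of all interpretations; FCC is the theory of those interpretations that satisfy $\mathsf{card}_{\mathsf S,k}$ exactly when $|\mathsf S|\le k$, for every $k>0$. Atoms are the $\mathsf{card}_{\mathsf S,k}$ and the equalities $s\approx t$ between ground terms, of the same sort, over the signature without the constants $\mathsf{card}_{\mathsf S,k}$; a literal $l$ is an atom or its negation, with complement $\bar l$; a clause is a finite set of literals, read as a disjunction. For a set $M$ of literals let $\mathbf T_M$ be the set of terms and subterms occurring in $M$, and let the congruence closure $M^*$ be the smallest set $X\supseteq M$ such that every element of $X\setminus M$ is an equality or disequality between elements of $\mathbf T_M$, and such that, for $s,t\in\mathbf T_M$ of the same sort, $X\models_{\mathrm{EUF}}s\approx t$ iff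 $(s\approx t)\in X$. The classes of $M$ are the equivalence classes of $\mathsf S$-terms in $\mathbf T_M$ under $M^*$. **States and rules.** States are $\langle M,F,C\rangle$, with $M$ a sequence of literals and decision points $\bullet$, $F$ a finite set of clauses, and $C$ one of $\mathsf{no}$, a conflict clause, or $\bot$. The level of a literal in $M$ is the number of $\bullet$ before it, $M^{[i]}$ is the prefix of $M$ formed by the levels $0,\dots,i$, and $\mathrm{Lit}_F$, $\mathrm{Lit}_M$ are the sets of literals occurring in $F$, $M$ together with their complements. For $i=0$, "$l_1,\dots,l_n\models_0 l$" means $\bar l_1\vee\dots\vee\bar l_n\vee l\in F$, and "$l_1,\dots,l_n\models_0\bot$" means $\bar l_1\vee\dots\vee\bar l_n\in F$; $\models_1$ is entailment in FCC. For $i\in\{0,1\}$ the rules are: * $\mathsf{Propagate}_i$: if $l_1,\dots,l_n\in M$, $l_1,\dots,l_n\models_i l$, $l\in\mathrm{Lit}_F$ and $l,\bar l\notin M$, then $M:=M\,l$. * $\mathsf{Decide}$: if $l\in\mathrm{Lit}_F$ and $l,\bar l\notin M$, then $M:=M\bullet l$. * $\mathsf{Conflict}_i$: if $C=\mathsf{no}$,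 $l_1,\dots,l_n\in M$ and $l_1,\dots,l_n\models_i\bot$, then $C:=\bar l_1\vee\dots\vee\bar l_n$. * $\mathsf{Explain}_i$: if $C=l\vee D$ with $l\notin D$, $\bar l_1,\dots,\bar l_n\models_i\bar l$, and each $\bar l_j$ occurs before $\bar l$ in $M$, then $C:=l_1\vee\dots\vee l_n\vee D$. * $\mathsf{Learn}_1$: add to $F$ an FCC-valid clause with all its literals in $\mathrm{Lit}_M\cup L$, where $L$ is the finite set of equalities and disequalities between $\mathsf S$-terms occurring (possibly as subterms) in $F_0$. * $\mathsf{Learn}_0$: if $C$ is a clause and $\bullet\in M$, add $C$ to $F$. * $\mathsf{Backjump}$: if $C=D\vee l$ with $l\notin D$, and $i$ is such that the complements of the literals of $D$ occur in $M$ at levels $\le i$ and $\bar l$ occurs in $M$ at a level $>i$, then $C:=\mathsf{no}$ and $M:=M^{[i]}\,l$. **Weak effort check.** (1) If some $l_1,\dots,l_n\in M$ are EUF-unsatisfiable, apply $\mathsf{Conflict}_1$ to such literals and return false. (2) Else, if $\mathsf{card}_{\mathsf S,k},\neg\mathsf{card}_{\mathsf S,j}\in M$ with $j>k$, apply $\mathsf{Conflict}_1$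 with $C:=\neg\mathsf{card}_{\mathsf S,k}\vee\mathsf{card}_{\mathsf S,j}$ and return false. (3) Else, if $\mathsf{card}_{\mathsf S,k}\in M$ and there are $\mathsf S$-terms $t_1,\dots,t_{k+1}\in\mathbf T_M$ with $M\models_{\mathrm{EUF}}t_i\not\approx t_j$ for all $i<j$, such that the clique lemma $\neg\mathsf{card}_{\mathsf S,k}\vee\bigvee_{i<j}t_i\approx t_j$ is not in $F$, apply $\mathsf{Learn}_1$ to such a lemma and return false. (4) Else return true. **Strong effort check.** If $M$ contains no $\mathsf{card}_{\mathsf S,k}$, return true. Otherwise let $k$ be the least integer with $\mathsf{card}_{\mathsf S,k}\in M$ and let $t_1,\dots,t_n$ be representatives of the classes of $M$. If $n\le k$, return true. If $n>k$, choose $i<j$ with $M\not\models_{\mathrm{EUF}}t_i\not\approx t_j$, apply $\mathsf{Learn}_1$ to $t_i\approx t_j\vee t_i\not\approx t_j$, and return false. **Strategy $\mathsf{check}_{\mathrm{FCC}}$** on a finite set $F_0$ of ground clauses. Start $\mathsf{check}$ in $\langle\emptyset,F_0,\mathsf{no}\rangle$. * $\mathsf{check}$: apply $\mathsf{Propagate}_0$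 and $\mathsf{Propagate}_1$ zero or more times. Then either apply $\mathsf{Conflict}_0$, if applicable, or run the weak effort check. If the weak effort check returns true and some $l\in\mathrm{Lit}_F$ is unassigned ($l,\bar l\notin M$), apply $\mathsf{Decide}$. If it returns true and all of $\mathrm{Lit}_F$ is assigned, apply $\mathsf{Conflict}_0$ if it is applicable; otherwise run the strong effort check, and return $\langle M,F,\mathsf{no}\rangle$ if that returns true. In all other cases continue with $\mathsf{check\_conflict}$. * $\mathsf{check\_conflict}$: if $C=\mathsf{no}$, go to $\mathsf{check}$. Otherwise apply $\mathsf{Explain}_0$ and $\mathsf{Explain}_1$ zero or more times; then, if $C=\emptyset$, return $\langle M,F,\bot\rangle$; else apply $\mathsf{Learn}_0$ followed by $\mathsf{Backjump}$ (possible when the premises of both hold) and go to $\mathsf{check}$. All choices left open are nondeterministic; an execution is any sequence of configurations obtained in this way. **Theorem.** For every finite set $F_0$ of ground clauses, $\mathsf{check}_{\mathrm{FCC}}$ is 1. *sound*: if an execution reaches a state $\langle M,F,\bot\rangle$, then $F_0$ is FCC-unsatisfiable; 2. *complete*: every finite execution that cannot be continued has returned a state $\langle M,F,\bot\rangle$,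 or a state $\langle M,F,\mathsf{no}\rangle$ such that the literals of $M$ are FCC-satisfiable and propositionally entail $F_0$; 3. *terminating*: every execution is finite. -/

import Mathlib

universe u

namespace FCC

/-! ## Signatures, ground terms, literals, clauses -/

/-- The sorts: the Boolean sort and one uninterpreted sort. -/
inductive Srt : Type
  | bool
  | S

/-- A signature of uninterpreted (sorted) function symbols. The constants `true` and `false` of the
Boolean sort are not listed here: every signature has them, see `Term`. Predicate symbols are
function symbols with result sort `bool`. -/
structure Signature where
  Func : Type u
  arity : Func → ℕ
  dom : (f : Func) → Fin (arity f) → Srt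
  cod : Func → Srt

/-- Well-sorted ground terms over the signature. -/
inductive Term (Sg : Signature.{u}) : Srt → Type u
  | tt : Term Sg Srt.bool
  | ff : Term Sg Srt.bool
  | app (f : Sg.Func) (args : (i : Fin (Sg.arity f)) → Term Sg (Sg.dom f i)) : Term Sg (Sg.cod f)

/-- `Subterm s t`: the term `s` is `t` or occurs in `t`. -/
inductive Subterm {Sg : Signature.{u}} {σ : Srt} (s : Term Sg σ) : {τ : Srt} → Term Sg τ → Prop
  | refl : Subterm s s
  | arg (f : Sg.Func) (args : (i : Fin (Sg.arity f)) → Term Sg (Sg.dom f i))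
      (i : Fin (Sg.arity f)) : Subterm s (args i) → Subterm s (Term.app f args)

/-- Ground atoms: equalities between terms of the same sort, and the cardinality constraints
`card_{S,k}` with `k > 0`. -/
inductive Atom (Sg : Signature.{u}) : Type u
  | eq {σ : Srt} (s t : Term Sg σ) : Atom Sg
  | card (k : ℕ+) : Atom Sg

/-- Ground literals. -/
inductive Literal (Sg : Signature.{u}) : Type u
  | pos (a : Atom Sg) : Literal Sg
  | neg (a : Atom Sg) : Literal Sg

noncomputable instance (Sg : Signature.{u}) : DecidableEq (Literal Sg) := Classical.decEq _

/-- The complement of a literal. -/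
def Literal.compl {Sg : Signature.{u}} : Literal Sg → Literal Sg
  | .pos a => .neg a
  | .neg a => .pos a

/-- The atom of a literal. -/
def Literal.atom {Sg : Signature.{u}} : Literal Sg → Atom Sg
  | .pos a => a
  | .neg a => a

/-- A ground clause is a disjunction of finitely many ground literals, seen as a set. -/
abbrev Clause (Sg : Signature.{u}) : Type u := Finset (Literal Sg)

/-- The term `t` occurs in the atom, possibly as a proper subterm. -/
def Atom.Has {Sg : Signature.{u}} {σ : Srt} (t : Term Sg σ) : Atom Sg → Prop
  | .eq s s' => Subterm t s ∨ Subterm t s'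
  | .card _ => False

/-- `t` is a term or subterm occurring in the set of literals `Γ`. -/
def TermOf {Sg : Signature.{u}} (Γ : Set (Literal Sg)) {σ : Srt} (t : Term Sg σ) : Prop :=
  ∃ l ∈ Γ, l.atom.Has t

/-! ## Interpretations, the theories EUF and FCC -/

/-- Interpretations of the signature extended with the Boolean constants `card_{S,k}`.
The Boolean sort is interpreted as a set with exactly the two elements `tt ≠ ff`. -/
structure Interp (Sg : Signature.{u}) where
  Dom : Srt → Type
  nonempty : ∀ σ, Nonempty (Dom σ)
  tt : Dom Srt.bool
  ff : Dom Srt.bool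
  tt_ne_ff : tt ≠ ff
  bool_cases : ∀ b : Dom Srt.bool, b = tt ∨ b = ff
  func : (f : Sg.Func) → ((i : Fin (Sg.arity f)) → Dom (Sg.dom f i)) → Dom (Sg.cod f)
  card : ℕ+ → Dom Srt.bool

/-- Evaluation of ground terms. -/
def Interp.eval {Sg : Signature.{u}} (I : Interp Sg) : {σ : Srt} → Term Sg σ → I.Dom σ
  | _, .tt => I.tt
  | _, .ff => I.ff
  | _, .app f args => I.func f (fun i => I.eval (args i))

def Interp.SatAtom {Sg : Signature.{u}} (I : Interp Sg) : Atom Sg → Prop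
  | .eq s t => I.eval s = I.eval t
  | .card k => I.card k = I.tt

def Interp.SatLit {Sg : Signature.{u}} (I : Interp Sg) : Literal Sg → Prop
  | .pos a => I.SatAtom a
  | .neg a => ¬ I.SatAtom a

def Interp.SatClause {Sg : Signature.{u}} (I : Interp Sg) (c : Clause Sg) : Prop :=
  ∃ l ∈ c, I.SatLit l

/-- The models of FCC: the interpretations that satisfy `card_{S,k}` exactly when they interpret
the sort `S` as a set of cardinality at most `k`. (All interpretations are models of EUF.) -/
def Interp.IsFCC {Sg : Signature.{u}} (I : Interp Sg) : Prop :=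
  ∀ k : ℕ+, I.SatAtom (.card k) ↔ ENat.card (I.Dom Srt.S) ≤ ((k : ℕ) : ℕ∞)

/-- `Γ` entails the literal `l` in EUF. -/
def EUFEntails {Sg : Signature.{u}} (Γ : Set (Literal Sg)) (l : Literal Sg) : Prop :=
  ∀ I : Interp Sg, (∀ x ∈ Γ, I.SatLit x) → I.SatLit l

/-- `Γ` is EUF-unsatisfiable. -/
def EUFUnsat {Sg : Signature.{u}} (Γ : Set (Literal Sg)) : Prop :=
  ∀ I : Interp Sg, ¬ ∀ x ∈ Γ, I.SatLit x

/-- `Γ` entails the literal `l` in FCC. -/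
def FCCEntails {Sg : Signature.{u}} (Γ : Set (Literal Sg)) (l : Literal Sg) : Prop :=
  ∀ I : Interp Sg, I.IsFCC → (∀ x ∈ Γ, I.SatLit x) → I.SatLit l

/-- `Γ` is FCC-satisfiable. -/
def FCCSat {Sg : Signature.{u}} (Γ : Set (Literal Sg)) : Prop :=
  ∃ I : Interp Sg, I.IsFCC ∧ ∀ x ∈ Γ, I.SatLit x

/-- The clause is FCC-valid. -/
def FCCValid {Sg : Signature.{u}} (c : Clause Sg) : Prop :=
  ∀ I : Interp Sg, I.IsFCC → I.SatClause c

/-- The clause set is FCC-satisfiable. -/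
def FCCSatClauses {Sg : Signature.{u}} (F : Finset (Clause Sg)) : Prop :=
  ∃ I : Interp Sg, I.IsFCC ∧ ∀ c ∈ F, I.SatClause c

/-- Truth of a literal under a propositional valuation of the atoms. -/
def Literal.PropSat {Sg : Signature.{u}} (v : Atom Sg → Prop) : Literal Sg → Prop
  | .pos a => v a
  | .neg a => ¬ v a

/-- `Γ` propositionally entails every clause of `F`. -/
def PropEntails {Sg : Signature.{u}} (Γ : Set (Literal Sg)) (F : Finset (Clause Sg)) : Prop :=
  ∀ c ∈ F, ∀ v : Atom Sg → Prop, (∀ l ∈ Γ, l.PropSat v) → ∃ l ∈ c, l.PropSat v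

/-! ## Congruence closure -/

/-- The two conditions that define the congruence closure of `Γ` as the smallest such `X`. -/
def IsCongClosed {Sg : Signature.{u}} (Γ X : Set (Literal Sg)) : Prop :=
  Γ ⊆ X ∧
  (∀ l ∈ X, l ∈ Γ ∨ ∃ (σ : Srt) (s t : Term Sg σ), TermOf Γ s ∧ TermOf Γ t ∧ l.atom = .eq s t) ∧
  ∀ (σ : Srt) (s t : Term Sg σ), TermOf Γ s → TermOf Γ t →
    (EUFEntails X (.pos (.eq s t)) ↔ Literal.pos (.eq s t) ∈ X)

/-- The congruence closure of `Γ`. -/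
def congClosure {Sg : Signature.{u}} (Γ : Set (Literal Sg)) : Set (Literal Sg) :=
  {l | ∀ X, IsCongClosed Γ X → l ∈ X}

/-- `t 0, …, t (n-1)` are representatives of the equivalence classes of sort `S` in the
congruence closure of `Γ`, one for each class. -/
def IsReps {Sg : Signature.{u}} (Γ : Set (Literal Sg)) (n : ℕ) (t : Fin n → Term Sg Srt.S) : Prop :=
  (∀ i, TermOf Γ (t i)) ∧
  ∀ s : Term Sg Srt.S, TermOf Γ s → ∃! i, Literal.pos (.eq s (t i)) ∈ congClosure Γ

/-! ## States and rules of DPLL(FCC) -/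

/-- An assignment is a sequence of literals and decision points, oldest first. -/
inductive Entry (Sg : Signature.{u}) : Type u
  | dec : Entry Sg
  | lit (l : Literal Sg) : Entry Sg

abbrev Assignment (Sg : Signature.{u}) : Type u := List (Entry Sg)

/-- The conflict component of a state: `no`, a conflict clause, or the failure value `⊥`. -/
inductive Conf (Sg : Signature.{u}) : Type u
  | no : Conf Sg
  | clause (c : Clause Sg) : Conf Sg
  | bot : Conf Sg

structure State (Sg : Signature.{u}) where
  M : Assignment Sg
  F : Finset (Clause Sg)
  C : Conf Sg

/-- The set of literals of an assignment. -/
def Assignment.lits {Sg : Signature.{u}} (M : Assignment Sg) : Set (Literal Sg) :=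
  {l | Entry.lit l ∈ M}

/-- `l` occurs before `l'` in `M`. -/
def Before {Sg : Signature.{u}} (M : Assignment Sg) (l l' : Literal Sg) : Prop :=
  ∃ M₁ M₂ M₃ : Assignment Sg, M = M₁ ++ Entry.lit l :: (M₂ ++ Entry.lit l' :: M₃)

/-- The number of decision points. -/
def numDec {Sg : Signature.{u}} : Assignment Sg → ℕ
  | [] => 0
  | .dec :: M => numDec M + 1
  | .lit _ :: M => numDec M

/-- `l` occurs in `M` at decision level `i`. -/
def HasLev {Sg : Signature.{u}} (M : Assignment Sg) (l : Literal Sg) (i : ℕ) : Prop :=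
  ∃ M₁ M₂ : Assignment Sg, M = M₁ ++ Entry.lit l :: M₂ ∧ numDec M₁ = i

/-- The prefix of `M` that consists of the decision levels `0, …, i`. -/
def upToLev {Sg : Signature.{u}} : ℕ → Assignment Sg → Assignment Sg
  | _, [] => []
  | i, .lit l :: M => .lit l :: upToLev i M
  | 0, .dec :: _ => []
  | i + 1, .dec :: M => .dec :: upToLev i M

/-- The literals of a clause set and their complements. -/
def litsF {Sg : Signature.{u}} (F : Finset (Clause Sg)) : Set (Literal Sg) :=
  {l | ∃ c ∈ F, l ∈ c ∨ l.compl ∈ c}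

/-- The literals of an assignment and their complements. -/
def litsM {Sg : Signature.{u}} (M : Assignment Sg) : Set (Literal Sg) :=
  {l | l ∈ M.lits ∨ l.compl ∈ M.lits}

/-- The two reasoning components: the SAT engine (rule index 0) and the theory FCC. With a single
theory there are no interface literals. -/
inductive Idx : Type
  | sat
  | thy

/-- `l₁, …, lₙ ⊨ᵢ l` for `ls = {l₁, …, lₙ}`. -/
def Ent {Sg : Signature.{u}} (F : Finset (Clause Sg)) (ls : Finset (Literal Sg)) (l : Literal Sg) :
    Idx → Prop
  | .sat => insert l (ls.image Literal.compl) ∈ F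
  | .thy => FCCEntails (↑ls) l

/-- `l₁, …, lₙ ⊨ᵢ ⊥` for `ls = {l₁, …, lₙ}`. -/
def EntBot {Sg : Signature.{u}} (F : Finset (Clause Sg)) (ls : Finset (Literal Sg)) : Idx → Prop
  | .sat => ls.image Literal.compl ∈ F
  | .thy => ¬ FCCSat (Sg := Sg) (↑ls)

def Propagate {Sg : Signature.{u}} (i : Idx) (s s' : State Sg) : Prop :=
  ∃ (ls : Finset (Literal Sg)) (l : Literal Sg),
    (∀ x ∈ ls, x ∈ s.M.lits) ∧ Ent s.F ls l i ∧ l ∈ litsF s.F ∧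
    l ∉ s.M.lits ∧ l.compl ∉ s.M.lits ∧
    s' = { s with M := s.M ++ [Entry.lit l] }

def Decide {Sg : Signature.{u}} (s s' : State Sg) : Prop :=
  ∃ l : Literal Sg, l ∈ litsF s.F ∧ l ∉ s.M.lits ∧ l.compl ∉ s.M.lits ∧
    s' = { s with M := s.M ++ [Entry.dec, Entry.lit l] }

/-- The rule Conflict on the literals `ls`. -/
def Conflict {Sg : Signature.{u}} (i : Idx) (ls : Finset (Literal Sg)) (s s' : State Sg) : Prop :=
  s.C = .no ∧ (∀ x ∈ ls, x ∈ s.M.lits) ∧ EntBot s.F ls i ∧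
    s' = { s with C := .clause (ls.image Literal.compl) }

def Explain {Sg : Signature.{u}} (i : Idx) (s s' : State Sg) : Prop :=
  ∃ (l : Literal Sg) (D ls : Clause Sg),
    l ∉ D ∧ s.C = .clause (insert l D) ∧
    Ent s.F (ls.image Literal.compl) l.compl i ∧
    (∀ x ∈ ls, Before s.M x.compl l.compl) ∧
    s' = { s with C := .clause (ls ∪ D) }

/-- The rule Learn of the theory FCC, with the clause `c`; `L` is the set of additional literals
that may be introduced. -/
def LearnThy {Sg : Signature.{u}} (L : Set (Literal Sg)) (c : Clause Sg) (s s' : State Sg) : Prop :=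
  FCCValid c ∧ (∀ l ∈ c, l ∈ litsM s.M ∪ L) ∧ s' = { s with F := insert c s.F }

/-- The rule Learn of the SAT engine. -/
def LearnSat {Sg : Signature.{u}} (s s' : State Sg) : Prop :=
  ∃ c : Clause Sg, s.C = .clause c ∧ Entry.dec ∈ s.M ∧ s' = { s with F := insert c s.F }

def Backjump {Sg : Signature.{u}} (s s' : State Sg) : Prop :=
  ∃ (l : Literal Sg) (D : Clause Sg) (i : ℕ),
    l ∉ D ∧ s.C = .clause (insert l D) ∧
    (∀ x ∈ D, ∃ j, j ≤ i ∧ HasLev s.M x.compl j) ∧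
    (∃ j, i < j ∧ HasLev s.M l.compl j) ∧
    s' = { s with M := upToLev i s.M ++ [Entry.lit l], C := .no }

/-! ## The weak and strong effort checks for FCC -/

/-- The literals that the checks may introduce: the equalities and disequalities between terms of
sort `S` that occur in the input clauses. -/
def learnable {Sg : Signature.{u}} (F₀ : Finset (Clause Sg)) : Set (Literal Sg) :=
  {l | ∃ s t : Term Sg Srt.S, TermOf (litsF F₀) s ∧ TermOf (litsF F₀) t ∧ l.atom = .eq s t}

/-- `M` entails `distinct(t₀, …, tₙ₋₁)` in EUF. -/
def EntailsDistinct {Sg : Signature.{u}} (Γ : Set (Literal Sg)) {n : ℕ}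
    (t : Fin n → Term Sg Srt.S) : Prop :=
  ∀ i j, i < j → EUFEntails Γ (.neg (.eq (t i) (t j)))

/-- The clique lemma `¬ card_{S,k} ∨ ¬ distinct(t₀, …, tₖ)`, as a clause. -/
noncomputable def cliqueLemma {Sg : Signature.{u}} (k : ℕ+)
    (t : Fin ((k : ℕ) + 1) → Term Sg Srt.S) : Clause Sg :=
  insert (.neg (.card k))
    (((Finset.univ : Finset (Fin ((k : ℕ) + 1) × Fin ((k : ℕ) + 1))).filter
      (fun p => p.1 < p.2)).image (fun p => Literal.pos (.eq (t p.1) (t p.2))))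

/-- Some literals of `M` are EUF-unsatisfiable. -/
def HasCongConflict {Sg : Signature.{u}} (s : State Sg) : Prop :=
  ∃ ls : Finset (Literal Sg), (∀ x ∈ ls, x ∈ s.M.lits) ∧ EUFUnsat (Sg := Sg) (↑ls)

/-- `M` contains `card_{S,k}` and `¬ card_{S,j}` with `j > k`. -/
def IsCardConflict {Sg : Signature.{u}} (s : State Sg) (k j : ℕ+) : Prop :=
  Literal.pos (.card k) ∈ s.M.lits ∧ Literal.neg (.card j) ∈ s.M.lits ∧ k < j

def HasCardConflict {Sg : Signature.{u}} (s : State Sg) : Prop :=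
  ∃ k j, IsCardConflict s k j

/-- `M` contains `card_{S,k}` and entails that `k + 1` of its terms are distinct, and the clique
lemma is not yet in `F`. -/
def IsClique {Sg : Signature.{u}} (s : State Sg) (k : ℕ+)
    (t : Fin ((k : ℕ) + 1) → Term Sg Srt.S) : Prop :=
  Literal.pos (.card k) ∈ s.M.lits ∧ (∀ i, TermOf s.M.lits (t i)) ∧
    EntailsDistinct s.M.lits t ∧ cliqueLemma k t ∉ s.F

def HasClique {Sg : Signature.{u}} (s : State Sg) : Prop :=
  ∃ k t, IsClique s k t

/-- The weak effort check applies a rule, leading from `s` to `s'`, and returns `false`. -/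
inductive WeakFalse {Sg : Signature.{u}} (F₀ : Finset (Clause Sg)) (s s' : State Sg) : Prop
  | cong (ls : Finset (Literal Sg)) :
      EUFUnsat (Sg := Sg) (↑ls) → Conflict .thy ls s s' → WeakFalse F₀ s s'
  | card (k j : ℕ+) :
      ¬ HasCongConflict s → IsCardConflict s k j →
      Conflict .thy {.pos (.card k), .neg (.card j)} s s' → WeakFalse F₀ s s'
  | clique (k : ℕ+) (t : Fin ((k : ℕ) + 1) → Term Sg Srt.S) :
      ¬ HasCongConflict s → ¬ HasCardConflict s → IsClique s k t →
      LearnThy (learnable F₀) (cliqueLemma k t) s s' → WeakFalse F₀ s s'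

/-- The weak effort check applies no rule and returns `true`. -/
def WeakTrue {Sg : Signature.{u}} (s : State Sg) : Prop :=
  ¬ HasCongConflict s ∧ ¬ HasCardConflict s ∧ ¬ HasClique s

/-- `k` is the smallest integer such that `card_{S,k}` is in `M`. -/
def IsMinCard {Sg : Signature.{u}} (M : Assignment Sg) (k : ℕ+) : Prop :=
  IsLeast {k : ℕ+ | Literal.pos (.card k) ∈ M.lits} k

/-- The strong effort check learns a splitting lemma `tᵢ ≈ tⱼ ∨ tᵢ ≉ tⱼ` and returns `false`. -/
def StrongFalse {Sg : Signature.{u}} (F₀ : Finset (Clause Sg)) (s s' : State Sg) : Prop :=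
  ∃ (k : ℕ+) (n : ℕ) (t : Fin n → Term Sg Srt.S) (i j : Fin n),
    IsMinCard s.M k ∧ IsReps s.M.lits n t ∧ (k : ℕ) < n ∧ i < j ∧
    ¬ EUFEntails s.M.lits (.neg (.eq (t i) (t j))) ∧
    LearnThy (learnable F₀) {.pos (.eq (t i) (t j)), .neg (.eq (t i) (t j))} s s'

/-- The strong effort check applies no rule and returns `true`: `M` has no positive cardinality
literal, or at most as many equivalence classes of sort `S` as the least one allows. -/
def StrongTrue {Sg : Signature.{u}} (s : State Sg) : Prop :=
  (∀ k : ℕ+, Literal.pos (.card k) ∉ s.M.lits) ∨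
  ∃ (k : ℕ+) (n : ℕ) (t : Fin n → Term Sg Srt.S),
    IsMinCard s.M k ∧ IsReps s.M.lits n t ∧ n ≤ (k : ℕ)

/-! ## The strategy -/

/-- Control points: the beginning of `check` (within its propagation loop), the beginning of
`check_conflict` (within its explanation loop), and after the return. -/
inductive Loc : Type
  | check
  | conflict
  | returned

structure Config (Sg : Signature.{u}) where
  loc : Loc
  st : State Sg

/-- Every literal of `F` is assigned. -/
def AllAssigned {Sg : Signature.{u}} (s : State Sg) : Prop :=
  ∀ l ∈ litsF s.F, l ∈ s.M.lits ∨ l.compl ∈ s.M.lits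

/-- One step of the strategy `check_FCC` on input `F₀`. All choices that the strategy leaves open
are nondeterministic. The conflict rule of the SAT engine may be applied after any number of
propagations, and has to be applied, if it applies, before the strong effort check. -/
inductive Step {Sg : Signature.{u}} (F₀ : Finset (Clause Sg)) : Config Sg → Config Sg → Prop
  | propagate (i : Idx) (s s' : State Sg) : Propagate i s s' → Step F₀ ⟨.check, s⟩ ⟨.check, s'⟩
  | satConflict (ls : Finset (Literal Sg)) (s s' : State Sg) :
      Conflict .sat ls s s' → Step F₀ ⟨.check, s⟩ ⟨.conflict, s'⟩
  | weakFalse (s s' : State Sg) : WeakFalse F₀ s s' → Step F₀ ⟨.check, s⟩ ⟨.conflict, s'⟩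
  | decide (s s' : State Sg) :
      WeakTrue s → Decide s s' → Step F₀ ⟨.check, s⟩ ⟨.conflict, s'⟩
  | strongFalse (s s' : State Sg) :
      WeakTrue s → AllAssigned s → (∀ ls s'', ¬ Conflict .sat ls s s'') →
      StrongFalse F₀ s s' → Step F₀ ⟨.check, s⟩ ⟨.conflict, s'⟩
  | strongTrue (s : State Sg) :
      WeakTrue s → AllAssigned s → (∀ ls s'', ¬ Conflict .sat ls s s'') →
      StrongTrue s → Step F₀ ⟨.check, s⟩ ⟨.returned, s⟩
  | noConflict (s : State Sg) : s.C = .no → Step F₀ ⟨.conflict, s⟩ ⟨.check, s⟩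
  | explain (i : Idx) (s s' : State Sg) :
      Explain i s s' → Step F₀ ⟨.conflict, s⟩ ⟨.conflict, s'⟩
  | fail (s : State Sg) :
      s.C = .clause ∅ → Step F₀ ⟨.conflict, s⟩ ⟨.returned, { s with C := .bot }⟩
  | learnBackjump (s s₁ s' : State Sg) :
      LearnSat s s₁ → Backjump s₁ s' → Step F₀ ⟨.conflict, s⟩ ⟨.check, s'⟩

/-- The initial configuration. -/
def init {Sg : Signature.{u}} (F₀ : Finset (Clause Sg)) : Config Sg :=
  ⟨.check, ⟨[], F₀, .no⟩⟩

/-- `c` is the last configuration of some finite execution of the strategy on input `F₀`. -/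
def Reachable {Sg : Signature.{u}} (F₀ : Finset (Clause Sg)) (c : Config Sg) : Prop :=
  Relation.ReflTransGen (Step F₀) (init F₀) c

/-- Every execution is finite. -/
def Terminating {Sg : Signature.{u}} (F₀ : Finset (Clause Sg)) : Prop :=
  ¬ ∃ r : ℕ → Config Sg, r 0 = init F₀ ∧ ∀ n, Step F₀ (r n) (r (n + 1))

/-- Every execution that ends in a state `⟨M, F, ⊥⟩` has an FCC-unsatisfiable input. -/
def Sound {Sg : Signature.{u}} (F₀ : Finset (Clause Sg)) : Prop :=
  ∀ c, Reachable F₀ c → c.st.C = .bot → ¬ FCCSatClauses F₀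

/-- Every execution that cannot be continued has returned, either `⟨M, F, ⊥⟩`, or `⟨M, F, no⟩`
where `M` is FCC-satisfiable and propositionally entails the input. -/
def Complete {Sg : Signature.{u}} (F₀ : Finset (Clause Sg)) : Prop :=
  ∀ c, Reachable F₀ c → (∀ c', ¬ Step F₀ c c') →
    c.loc = .returned ∧
    (c.st.C = .bot ∨ (c.st.C = .no ∧ FCCSat c.st.M.lits ∧ PropEntails c.st.M.lits F₀))

end FCC

namespace FCC

variable {Sg : Signature.{u}}

/-! ## Literals, subterms, finiteness -/

/-! All three claims rest on one invariant of reachable states (`Invariant`,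
`ConfigInvariant.step`). Soundness: every clause of `F`, and the conflict clause, holds in each
FCC-model of `F₀`. Learned theory lemmas are valid, conflict clauses are members of `F` or negated
unsatisfiable conjunctions, and Explain is resolution. An empty conflict clause therefore refutes
`F₀`.

Termination: learned lemmas only relate terms of `F₀`, so all literals lie in a finite universe, of
size K say. A literal at level j weighs (K+1)^(K+1-j); the progress of a state is the total weight
plus the number of clauses, and it is bounded. Propagate, Decide and new lemmas increase it. So does
Backjump: the new literal at level i outweighs the at most K literals removed above level i
(`Invariant.progress_lt_of_backjump`). The remaining steps keep the progress and lower a rank; for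
Explain, this rank reads the conflict clause as a binary number over the positions of `M`
(`Explain.posValue_lt`).

Completeness: a nonempty conflict clause that cannot be explained is falsified by decisions only,
one per level, so it admits a backjump (`exists_explain_or_backjump`). The strong check always finds
a pair to split, since otherwise a clique lemma would already be in `F` and be falsified. On a
return with `no`, `M` contains a literal of each clause and has an EUF-model. Only the values of the
finitely many terms of `M` matter, so the domain of `S` can be exchanged for ℕ, or for k elements
when the classes number at most k (`fccSat_of_embedding`). -/

@[simp] theorem Literal.compl_compl (l : Literal Sg) : l.compl.compl = l := by cases l <;> rfl

@[simp] theorem Literal.atom_compl (l : Literal Sg) : l.compl.atom = l.atom := by cases l <;> rfl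

theorem Literal.compl_injective : Function.Injective (Literal.compl (Sg := Sg)) :=
  Function.LeftInverse.injective Literal.compl_compl

@[simp] theorem image_compl_image_compl (c : Clause Sg) :
    (c.image Literal.compl).image Literal.compl = c := by
  ext l; simp

theorem mem_image_compl {c : Clause Sg} {l : Literal Sg} :
    l ∈ c.image Literal.compl ↔ l.compl ∈ c := by
  constructor
  · intro h
    obtain ⟨x, hx, rfl⟩ := Finset.mem_image.1 h
    simpa using hx
  · intro h
    exact Finset.mem_image.2 ⟨_, h, l.compl_compl⟩

@[simp] theorem Interp.satLit_compl (I : Interp Sg) (l : Literal Sg) :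
    I.SatLit l.compl ↔ ¬ I.SatLit l := by
  cases l <;> simp [Literal.compl, Interp.SatLit]

theorem Subterm.trans {ρ σ τ : Srt} {r : Term Sg ρ} {s : Term Sg σ} {t : Term Sg τ}
    (h₁ : Subterm r s) (h₂ : Subterm s t) : Subterm r t := by
  induction h₂ with
  | refl => exact h₁
  | arg f args i _ ih => exact .arg f args i ih

theorem Atom.Has.trans {σ τ : Srt} {s : Term Sg σ} {t : Term Sg τ} {a : Atom Sg}
    (h : Subterm s t) (ha : a.Has t) : a.Has s := by
  cases a with
  | eq u v => exact ha.imp h.trans h.trans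
  | card k => exact ha

theorem TermOf.subterm {Γ : Set (Literal Sg)} {σ τ : Srt} {s : Term Sg σ} {t : Term Sg τ}
    (ht : TermOf Γ t) (h : Subterm s t) : TermOf Γ s := by
  obtain ⟨l, hl, ha⟩ := ht
  exact ⟨l, hl, ha.trans h⟩

theorem TermOf.mono {Γ Δ : Set (Literal Sg)} (h : Γ ⊆ Δ) {σ : Srt} {t : Term Sg σ}
    (ht : TermOf Γ t) : TermOf Δ t := by
  obtain ⟨l, hl, ha⟩ := ht
  exact ⟨l, h hl, ha⟩

/-- The subterms of a term, of all sorts. -/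
def Term.subterms : {τ : Srt} → Term Sg τ → Set (Σ σ, Term Sg σ)
  | _, .tt => {⟨_, .tt⟩}
  | _, .ff => {⟨_, .ff⟩}
  | _, .app f args => {⟨_, .app f args⟩} ∪ ⋃ i, (args i).subterms

theorem Term.finite_subterms {τ : Srt} (t : Term Sg τ) : t.subterms.Finite := by
  induction t with
  | tt => exact Set.finite_singleton _
  | ff => exact Set.finite_singleton _
  | app f args ih => exact (Set.finite_singleton _).union (Set.finite_iUnion ih)

theorem Term.self_mem_subterms {τ : Srt} (t : Term Sg τ) : ⟨τ, t⟩ ∈ t.subterms := by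
  cases t <;> simp [Term.subterms]

theorem Subterm.mem_subterms {σ τ : Srt} {s : Term Sg σ} {t : Term Sg τ} (h : Subterm s t) :
    ⟨σ, s⟩ ∈ t.subterms := by
  induction h with
  | refl => exact s.self_mem_subterms
  | arg f args i _ ih => exact Or.inr (Set.mem_iUnion.2 ⟨i, ih⟩)

theorem finite_subterm (σ : Srt) {τ : Srt} (t : Term Sg τ) :
    {s : Term Sg σ | Subterm s t}.Finite := by
  refine Set.Finite.subset (t.finite_subterms.preimage (f := Sigma.mk σ) ?_)
    fun s h => h.mem_subterms
  exact sigma_mk_injective.injOn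

theorem finite_termOf {Γ : Set (Literal Sg)} (hΓ : Γ.Finite) (σ : Srt) :
    {t : Term Sg σ | TermOf Γ t}.Finite := by
  have : {t : Term Sg σ | TermOf Γ t} = ⋃ l ∈ Γ, {t | l.atom.Has t} := by
    ext t; simp [TermOf]
  rw [this]
  refine hΓ.biUnion fun l _ => ?_
  cases h : l.atom with
  | eq s t => exact (finite_subterm σ s).union (finite_subterm σ t)
  | card k => simp [Atom.Has]

/-- The literals that may occur in an execution on the input `F₀`. -/
def litUniverse (F₀ : Finset (Clause Sg)) : Set (Literal Sg) := litsF F₀ ∪ learnable F₀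

theorem finite_litsF (F : Finset (Clause Sg)) : (litsF F).Finite := by
  refine Set.Finite.subset (Finset.finite_toSet (F.biUnion fun c => c ∪ c.image Literal.compl)) ?_
  rintro l ⟨c, hc, h⟩
  simp only [Finset.coe_biUnion, Set.mem_iUnion]
  refine ⟨c, hc, ?_⟩
  rw [Finset.mem_coe, Finset.mem_union, mem_image_compl]
  exact h

theorem finite_learnable (F₀ : Finset (Clause Sg)) : (learnable F₀).Finite := by
  have hT := finite_termOf (finite_litsF F₀) Srt.S
  have h2 := hT.prod hT
  refine Set.Finite.subset
    ((h2.image fun p => Literal.pos (.eq p.1 p.2)).union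
      (h2.image fun p => Literal.neg (.eq p.1 p.2))) ?_
  rintro l ⟨s, t, hs, ht, h⟩
  cases l with
  | pos a => exact Or.inl ⟨(s, t), ⟨hs, ht⟩, by simp [Literal.atom] at h; simp [h]⟩
  | neg a => exact Or.inr ⟨(s, t), ⟨hs, ht⟩, by simp [Literal.atom] at h; simp [h]⟩

theorem finite_litUniverse (F₀ : Finset (Clause Sg)) : (litUniverse F₀).Finite :=
  (finite_litsF F₀).union (finite_learnable F₀)

theorem compl_mem_litsF {F : Finset (Clause Sg)} {l : Literal Sg} (h : l ∈ litsF F) :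
    l.compl ∈ litsF F := by
  obtain ⟨c, hc, h⟩ := h
  exact ⟨c, hc, by simpa using h.symm⟩

theorem compl_mem_litUniverse {F₀ : Finset (Clause Sg)} {l : Literal Sg}
    (h : l ∈ litUniverse F₀) : l.compl ∈ litUniverse F₀ := by
  rcases h with h | h
  · exact Or.inl (compl_mem_litsF h)
  · obtain ⟨s, t, hs, ht, h⟩ := h
    exact Or.inr ⟨s, t, hs, ht, by simpa using h⟩

/-- Learnable literals only recombine terms that already occur in `F₀`, so repeated learning never
leaves the universe. -/
theorem termOf_litsF_of_litUniverse {F₀ : Finset (Clause Sg)} {σ : Srt} {t : Term Sg σ}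
    (h : TermOf (litUniverse F₀) t) : TermOf (litsF F₀) t := by
  obtain ⟨l, hl | ⟨u, v, hu, hv, h⟩, ha⟩ := h
  · exact ⟨l, hl, ha⟩
  · rw [h] at ha
    exact ha.elim hu.subterm hv.subterm

/-! ## Congruence closure and representatives -/

/-- Adding entailed equalities does not change the models of `Γ`, so this set is closed; it bounds
`congClosure` from above. -/
theorem isCongClosed_entailed (Γ : Set (Literal Sg)) :
    IsCongClosed Γ {l | l ∈ Γ ∨ ∃ (σ : Srt) (s t : Term Sg σ), TermOf Γ s ∧ TermOf Γ t ∧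
      l = .pos (.eq s t) ∧ EUFEntails Γ l} := by
  refine ⟨fun l h => Or.inl h, ?_, fun σ s t hs ht => ⟨fun h => ?_, fun h I hI => hI _ h⟩⟩
  · rintro l (h | ⟨σ, s, t, hs, ht, rfl, -⟩)
    · exact Or.inl h
    · exact Or.inr ⟨σ, s, t, hs, ht, rfl⟩
  · refine Or.inr ⟨σ, s, t, hs, ht, rfl, fun I hI => h I ?_⟩
    rintro x (hx | ⟨_, _, _, _, _, _, hx⟩)
    · exact hI x hx
    · exact hx I hI

/-- Replaces the closure by semantic entailment; classes are handled only through this equivalence.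
-/
theorem eq_mem_congClosure {Γ : Set (Literal Sg)} {σ : Srt} {s t : Term Sg σ}
    (hs : TermOf Γ s) (ht : TermOf Γ t) :
    Literal.pos (.eq s t) ∈ congClosure Γ ↔ EUFEntails Γ (.pos (.eq s t)) := by
  constructor
  · intro h
    rcases h _ (isCongClosed_entailed Γ) with h | ⟨_, _, _, _, _, _, h⟩
    · exact fun I hI => hI _ h
    · exact h
  · intro h X hX
    exact (hX.2.2 σ s t hs ht).1 fun I hI => h I fun x hx => hI x (hX.1 hx)

theorem exists_isReps {Γ : Set (Literal Sg)} (hΓ : Γ.Finite) : ∃ n t, IsReps Γ n t := by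
  let T := {t : Term Sg Srt.S // TermOf Γ t}
  have : Finite T := (finite_termOf hΓ Srt.S).to_subtype
  let st : Setoid T :=
    { r := fun s t => EUFEntails Γ (.pos (.eq s.1 t.1))
      iseqv := ⟨fun _ _ _ => rfl, fun h I hI => (h I hI).symm,
        fun h h' I hI => (h I hI).trans (h' I hI)⟩ }
  obtain ⟨n, ⟨e⟩⟩ := Finite.exists_equiv_fin (Quotient st)
  refine ⟨n, fun i => (e.symm i).out.1, fun i => (e.symm i).out.2, fun s hs => ?_⟩
  have key : ∀ i, Literal.pos (.eq s (e.symm i).out.1) ∈ congClosure Γ ↔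
      i = e (Quotient.mk st ⟨s, hs⟩) := fun i => by
    rw [eq_mem_congClosure hs (e.symm i).out.2, ← Equiv.symm_apply_eq, eq_comm]
    conv_rhs => rw [← Quotient.out_eq (e.symm i)]
    exact (Quotient.eq (r := st) (x := ⟨s, hs⟩) (y := (e.symm i).out)).symm
  exact ⟨_, (key _).2 rfl, fun i hi => (key i).1 hi⟩

theorem IsReps.not_entails_eq {Γ : Set (Literal Sg)} {n : ℕ} {t : Fin n → Term Sg Srt.S}
    (h : IsReps Γ n t) {i j : Fin n} (hij : i ≠ j) : ¬ EUFEntails Γ (.pos (.eq (t i) (t j))) := by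
  intro he
  obtain ⟨_, -, hu⟩ := h.2 (t i) (h.1 i)
  have h₁ := hu i ((eq_mem_congClosure (h.1 i) (h.1 i)).2 fun _ _ => rfl)
  have h₂ := hu j ((eq_mem_congClosure (h.1 i) (h.1 j)).2 he)
  exact hij (h₁.trans h₂.symm)

/-! ## Changing the domain of the sort `S` -/

section Replace

variable (I : Interp Sg) (D : Type) (e : I.Dom Srt.S → D) (r : D → I.Dom Srt.S)

/-- The domains of `I`, with `D` for the sort `S`. -/
def Interp.ReplaceDom : Srt → Type
  | .bool => I.Dom .bool
  | .S => D

/-- The map between the domains induced by `e`. -/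
def Interp.replaceUp : (σ : Srt) → I.Dom σ → I.ReplaceDom D σ
  | .bool => id
  | .S => e

/-- The map between the domains induced by `r`. -/
def Interp.replaceDown : (σ : Srt) → I.ReplaceDom D σ → I.Dom σ
  | .bool => id
  | .S => r

open Classical in
/-- The interpretation with the domain `D` for the sort `S`, where functions are computed in `I`,
and the cardinality constraints have their meaning in FCC. -/
noncomputable def Interp.replace : Interp Sg where
  Dom := I.ReplaceDom D
  nonempty σ := (I.nonempty σ).map (I.replaceUp D e σ)
  tt := I.tt
  ff := I.ff
  tt_ne_ff := I.tt_ne_ff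
  bool_cases := I.bool_cases
  func f args := I.replaceUp D e _ (I.func f fun i => I.replaceDown D r _ (args i))
  card k := if ENat.card D ≤ ((k : ℕ) : ℕ∞) then I.tt else I.ff

theorem Interp.satAtom_replace_card (k : ℕ+) :
    (I.replace D e r).SatAtom (.card k) ↔ ENat.card D ≤ ((k : ℕ) : ℕ∞) := by
  change (if ENat.card D ≤ ((k : ℕ) : ℕ∞) then I.tt else I.ff) = I.tt ↔ _
  split_ifs with h
  · simp [h]
  · simp [h, I.tt_ne_ff.symm]

theorem Interp.isFCC_replace : (I.replace D e r).IsFCC := I.satAtom_replace_card D e r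

variable {I D e r} {Γ : Set (Literal Sg)}
  (hr : ∀ t : Term Sg Srt.S, TermOf Γ t → r (e (I.eval t)) = I.eval t)

include hr

theorem Interp.replaceDown_replaceUp {σ : Srt} {t : Term Sg σ} (ht : TermOf Γ t) :
    I.replaceDown D r σ (I.replaceUp D e σ (I.eval t)) = I.eval t := by
  cases σ with
  | bool => rfl
  | S => exact hr t ht

/-- Function arguments are pulled back along `r`, which undoes `e` only on values of terms of `Γ`;
closure of `TermOf Γ` under subterms makes the induction go through. -/
theorem Interp.eval_replace {σ : Srt} (t : Term Sg σ) (ht : TermOf Γ t) :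
    (I.replace D e r).eval t = I.replaceUp D e σ (I.eval t) := by
  induction t with
  | tt => rfl
  | ff => rfl
  | app f args ih =>
    have h : ∀ i, TermOf Γ (args i) := fun i => ht.subterm (.arg f args i .refl)
    change I.replaceUp D e _ (I.func f fun i => I.replaceDown D r _
      ((I.replace D e r).eval (args i))) = I.replaceUp D e _ (I.func f fun i => I.eval (args i))
    congr 2
    funext i
    rw [ih i (h i), Interp.replaceDown_replaceUp hr (h i)]

theorem Interp.satAtom_replace_eq {σ : Srt} {s t : Term Sg σ} (hs : TermOf Γ s)
    (ht : TermOf Γ t) :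
    (I.replace D e r).SatAtom (.eq s t) ↔ I.SatAtom (.eq s t) := by
  change (I.replace D e r).eval s = (I.replace D e r).eval t ↔ I.eval s = I.eval t
  rw [I.eval_replace hr s hs, I.eval_replace hr t ht]
  refine ⟨fun h => ?_, fun h => by rw [h]⟩
  rw [← I.replaceDown_replaceUp hr hs, h, I.replaceDown_replaceUp hr ht]

end Replace

/-- An EUF-model of `Γ` yields an FCC-model of `Γ` whose domain of sort `S` is `D`, if `D` is large
enough for the values of the terms of `Γ` and agrees with the cardinality literals of `Γ`. -/
theorem fccSat_of_embedding {Γ : Set (Literal Sg)} {I : Interp Sg} (hI : ∀ x ∈ Γ, I.SatLit x)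
    (D : Type) [Nonempty D]
    (e : {a : I.Dom Srt.S // ∃ t : Term Sg Srt.S, TermOf Γ t ∧ I.eval t = a} → D)
    (he : Function.Injective e)
    (hpos : ∀ k : ℕ+, Literal.pos (.card k) ∈ Γ → ENat.card D ≤ ((k : ℕ) : ℕ∞))
    (hneg : ∀ k : ℕ+, Literal.neg (.card k) ∈ Γ → ¬ ENat.card D ≤ ((k : ℕ) : ℕ∞)) :
    FCCSat Γ := by
  classical
  obtain ⟨a₀⟩ := I.nonempty Srt.S
  obtain ⟨d₀⟩ := ‹Nonempty D›
  -- The defaults `d₀` and `a₀` are never seen by terms of `Γ`: on their values `r` inverts `e'`.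
  let e' : I.Dom Srt.S → D := fun a =>
    if h : ∃ t : Term Sg Srt.S, TermOf Γ t ∧ I.eval t = a then e ⟨a, h⟩ else d₀
  let r : D → I.Dom Srt.S := fun d => if h : ∃ a, e a = d then h.choose.1 else a₀
  have hr : ∀ t : Term Sg Srt.S, TermOf Γ t → r (e' (I.eval t)) = I.eval t := fun t ht => by
    have h₁ : ∃ s : Term Sg Srt.S, TermOf Γ s ∧ I.eval s = I.eval t := ⟨t, ht, rfl⟩
    have h₂ : ∃ a, e a = e ⟨I.eval t, h₁⟩ := ⟨_, rfl⟩
    simp only [e', r, dif_pos h₁, dif_pos h₂]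
    rw [he h₂.choose_spec]
  have key : ∀ l ∈ Γ, ∀ a, l.atom = a → ((∃ k, a = .card k) ∨
      ((I.replace D e' r).SatAtom a ↔ I.SatAtom a)) := by
    rintro l hl a ha
    cases a with
    | card k => exact Or.inl ⟨k, rfl⟩
    | eq s t =>
      exact Or.inr (Interp.satAtom_replace_eq hr ⟨l, hl, by rw [ha]; exact Or.inl .refl⟩
        ⟨l, hl, by rw [ha]; exact Or.inr .refl⟩)
  refine ⟨I.replace D e' r, I.isFCC_replace D e' r, fun l hl => ?_⟩
  cases l with
  | pos a =>
    rcases key _ hl a rfl with ⟨k, rfl⟩ | h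
    · exact (I.satAtom_replace_card D e' r k).2 (hpos k hl)
    · exact h.2 (hI _ hl)
  | neg a =>
    rcases key _ hl a rfl with ⟨k, rfl⟩ | h
    · exact fun h => hneg k hl ((I.satAtom_replace_card D e' r k).1 h)
    · exact fun h' => hI _ hl (h.1 h')

/-- An infinite domain makes every negative cardinality literal true, and there is no positive one
to violate. -/
theorem fccSat_of_no_card {Γ : Set (Literal Sg)} (hΓ : Γ.Finite) (hsat : ¬ EUFUnsat Γ)
    (hcard : ∀ k : ℕ+, Literal.pos (.card k) ∉ Γ) : FCCSat Γ := by
  obtain ⟨I, hI⟩ := not_forall_not.1 hsat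
  have hA : {a : I.Dom Srt.S | ∃ t : Term Sg Srt.S, TermOf Γ t ∧ I.eval t = a}.Finite :=
    (finite_termOf hΓ Srt.S).image fun t => I.eval t
  have : Finite {a : I.Dom Srt.S // ∃ t : Term Sg Srt.S, TermOf Γ t ∧ I.eval t = a} :=
    hA.to_subtype
  obtain ⟨n, ⟨e⟩⟩ := Finite.exists_equiv_fin
    {a : I.Dom Srt.S // ∃ t : Term Sg Srt.S, TermOf Γ t ∧ I.eval t = a}
  refine fccSat_of_embedding hI ℕ (fun a => (e a : ℕ)) (Fin.val_injective.comp e.injective)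
    (fun k hk => absurd hk (hcard k)) fun k _ => ?_
  simp

/-- A domain of exactly `k` elements has room for the `n` classes. Positive constraints hold by
minimality of `k`; a negated one has index at most `k`, and not `k` itself because `Γ` is
EUF-satisfiable. -/
theorem fccSat_of_isReps {Γ : Set (Literal Sg)} (hsat : ¬ EUFUnsat Γ) {k : ℕ+}
    (hk : IsLeast {k : ℕ+ | Literal.pos (.card k) ∈ Γ} k)
    (hcard : ∀ j, Literal.neg (.card j) ∈ Γ → j ≤ k) {n : ℕ} {t : Fin n → Term Sg Srt.S}
    (ht : IsReps Γ n t) (hn : n ≤ (k : ℕ)) : FCCSat Γ := by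
  obtain ⟨I, hI⟩ := not_forall_not.1 hsat
  have hrep : ∀ a : {a : I.Dom Srt.S // ∃ t : Term Sg Srt.S, TermOf Γ t ∧ I.eval t = a},
      ∃ i, a.1 = I.eval (t i) := by
    rintro ⟨_, s, hs, rfl⟩
    obtain ⟨i, hi, -⟩ := ht.2 s hs
    exact ⟨i, (eq_mem_congClosure hs (ht.1 i)).1 hi I hI⟩
  choose e he using hrep
  have : Nonempty (Fin k) := ⟨⟨0, k.pos⟩⟩
  refine fccSat_of_embedding hI (Fin k) (fun a => Fin.castLE hn (e a)) (fun a b hab => ?_)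
    (fun j hj => ?_) fun j hj => ?_
  -- The index of a representative determines the value, hence the map is injective.
  · have : e a = e b := Fin.castLE_injective hn hab
    exact Subtype.ext (by rw [he a, he b, this])
  · simpa using hk.2 hj
  · have hne : j ≠ k := by
      rintro rfl
      exact hI _ hj (hI _ hk.1)
    simpa using lt_of_le_of_ne (hcard j hj) hne

/-! ## Valid lemmas -/

/-- Pigeonhole: `k + 1` terms cannot take distinct values in a domain of at most `k` elements. -/
theorem fccValid_cliqueLemma (k : ℕ+) (t : Fin ((k : ℕ) + 1) → Term Sg Srt.S) :
    FCCValid (cliqueLemma k t) := by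
  intro I hI
  by_cases hk : I.SatAtom (.card k)
  · have hle := (hI k).1 hk
    have hfin : Finite (I.Dom Srt.S) := by
      rw [← ENat.card_lt_top]
      exact lt_of_le_of_lt hle (ENat.natCast_lt_top _)
    have : ¬ Function.Injective fun i => I.eval (t i) := by
      intro hinj
      have h := Nat.card_le_card_of_injective _ hinj
      rw [ENat.card_eq_coe_natCard, Nat.cast_le] at hle
      simp at h
      omega
    simp only [Function.Injective, not_forall] at this
    obtain ⟨i, j, hij, hne⟩ := this
    have mem : ∀ i j, i < j → Literal.pos (.eq (t i) (t j)) ∈ cliqueLemma k t := fun i j h =>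
      Finset.mem_insert_of_mem (Finset.mem_image.2 ⟨(i, j), by simpa using h, rfl⟩)
    rcases lt_or_gt_of_ne hne with h | h
    · exact ⟨_, mem i j h, hij⟩
    · exact ⟨_, mem j i h, hij.symm⟩
  · exact ⟨_, Finset.mem_insert_self _ _, hk⟩

theorem fccValid_split (a : Atom Sg) : FCCValid {.pos a, .neg a} := by
  intro I _
  by_cases h : I.SatAtom a
  · exact ⟨.pos a, by simp, h⟩
  · exact ⟨.neg a, by simp, h⟩

theorem not_fccSat_card {k j : ℕ+} (h : k < j) :
    ¬ FCCSat (Sg := Sg) ↑({.pos (.card k), .neg (.card j)} : Finset (Literal Sg)) := by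
  rintro ⟨I, hI, hs⟩
  have h₁ : I.SatAtom (.card k) := hs (.pos (.card k)) (by simp)
  have h₂ : ¬ I.SatAtom (.card j) := hs (.neg (.card j)) (by simp)
  exact h₂ ((hI j).2 (((hI k).1 h₁).trans (by exact_mod_cast h.le)))

theorem not_fccSat_of_eufUnsat {Γ : Set (Literal Sg)} (h : EUFUnsat Γ) : ¬ FCCSat Γ :=
  fun ⟨I, _, hs⟩ => h I hs

/-! ## Assignments -/

/-- Every entry `e` of `M` satisfies `P M₁ e`, for the entries `M₁` before it. -/
def EachEntry (P : Assignment Sg → Entry Sg → Prop) (M : Assignment Sg) : Prop :=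
  ∀ M₁ e M₂, M = M₁ ++ e :: M₂ → P M₁ e

theorem EachEntry.concat {P : Assignment Sg → Entry Sg → Prop} {M : Assignment Sg} {e : Entry Sg}
    (h : EachEntry P M) (he : P M e) : EachEntry P (M ++ [e]) := by
  intro M₁ e' M₂ hM
  rcases List.eq_nil_or_concat M₂ with rfl | ⟨M₃, e'', rfl⟩
  · obtain ⟨rfl, h'⟩ := List.append_inj' hM rfl
    cases h'
    exact he
  · have : M ++ [e] = (M₁ ++ e' :: M₃) ++ [e''] := by simpa using hM
    exact h _ _ _ (List.append_inj' this rfl).1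

theorem EachEntry.of_prefix {P : Assignment Sg → Entry Sg → Prop} {M M' : Assignment Sg}
    (h : EachEntry P M) (hM : M' <+: M) : EachEntry P M' := by
  rintro M₁ e M₂ rfl
  obtain ⟨R, rfl⟩ := hM
  exact h M₁ e (M₂ ++ R) (by simp)

theorem EachEntry.mono {P Q : Assignment Sg → Entry Sg → Prop} {M : Assignment Sg}
    (h : EachEntry P M) (hPQ : ∀ M e, P M e → Q M e) : EachEntry Q M :=
  fun M₁ e M₂ hM => hPQ _ _ (h M₁ e M₂ hM)

theorem Assignment.mem_lits_concat {M : Assignment Sg} {l l' : Literal Sg} :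
    l' ∈ Assignment.lits (M ++ [.lit l]) ↔ l' ∈ M.lits ∨ l' = l := by
  simp [Assignment.lits]

theorem lits_of_prefix {M M' : Assignment Sg} (h : M' <+: M) : M'.lits ⊆ M.lits :=
  fun _ hl => h.subset hl

theorem finite_lits (M : Assignment Sg) : M.lits.Finite := by
  refine (List.finite_toSet M).preimage (f := Entry.lit) fun a _ b _ h => ?_
  exact Entry.lit.inj h

theorem exists_split_of_mem_lits {M : Assignment Sg} {l : Literal Sg} (h : l ∈ M.lits) :
    ∃ M₁ M₂ : Assignment Sg, M = M₁ ++ .lit l :: M₂ :=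
  List.append_of_mem h

/-- The number of literals of an assignment. -/
def numLit : Assignment Sg → ℕ
  | [] => 0
  | .dec :: M => numLit M
  | .lit _ :: M => numLit M + 1

@[simp] theorem numDec_append (M N : Assignment Sg) : numDec (M ++ N) = numDec M + numDec N := by
  induction M with
  | nil => simp [numDec]
  | cons e M ih => cases e <;> simp [numDec, ih]; omega

@[simp] theorem numLit_append (M N : Assignment Sg) : numLit (M ++ N) = numLit M + numLit N := by
  induction M with
  | nil => simp [numLit]
  | cons e M ih => cases e <;> simp [numLit, ih]; omega

/-- A decision point is determined by the number of decision points before it, so each level has a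
single decision. -/
theorem append_dec_inj {A B R R' : Assignment Sg} (h : A ++ .dec :: R = B ++ .dec :: R')
    (hd : numDec A = numDec B) : A = B ∧ R = R' := by
  induction A generalizing B with
  | nil =>
    cases B with
    | nil => simpa using h
    | cons b B =>
      simp only [List.nil_append, List.cons_append, List.cons.injEq] at h
      rw [← h.1] at hd
      simp [numDec] at hd
  | cons a A ih =>
    cases B with
    | nil =>
      simp only [List.nil_append, List.cons_append, List.cons.injEq] at h
      rw [h.1] at hd
      simp [numDec] at hd
    | cons b B =>
      simp only [List.cons_append, List.cons.injEq] at h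
      obtain ⟨rfl, h⟩ := h
      have := ih h (by cases a <;> simpa [numDec] using hd)
      simp [this]

theorem upToLev_split {M : Assignment Sg} {i : ℕ} (h : i < numDec M) :
    ∃ R, M = upToLev i M ++ .dec :: R ∧ numDec (upToLev i M) = i := by
  induction M generalizing i with
  | nil => simp [numDec] at h
  | cons e M ih =>
    cases e with
    | dec =>
      cases i with
      | zero => exact ⟨M, by simp [upToLev, numDec]⟩
      | succ i =>
        obtain ⟨R, h₁, h₂⟩ := ih (i := i) (by simpa [numDec] using h)
        exact ⟨R, by simpa [upToLev] using h₁, by simpa [upToLev, numDec] using h₂⟩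
    | lit l =>
      obtain ⟨R, h₁, h₂⟩ := ih (i := i) (by simpa [numDec] using h)
      exact ⟨R, by cases i <;> simpa [upToLev] using h₁,
        by cases i <;> simpa [upToLev, numDec] using h₂⟩

theorem mem_lits_upToLev {M : Assignment Sg} {l : Literal Sg} {i j : ℕ} (h : HasLev M l j)
    (hj : j ≤ i) : l ∈ (upToLev i M).lits := by
  obtain ⟨M₁, M₂, rfl, rfl⟩ := h
  induction M₁ generalizing i with
  | nil => cases i <;> simp [upToLev, Assignment.lits]
  | cons e M ih =>
    cases e with
    | dec =>
      cases i with
      | zero => simp [numDec] at hj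
      | succ i =>
        have := ih (i := i) (by simpa [numDec] using hj)
        simpa [upToLev, Assignment.lits] using this
    | lit l' =>
      have := ih (i := i) (by simpa [numDec] using hj)
      cases i <;> simpa [upToLev, Assignment.lits] using Or.inr this

/-! ## Admissible assignments -/

/-- The conditions on an entry of a reachable assignment, where `M₁` are the entries before it:
literals are new, and have been decided or have a reason. -/
def Admissible (F₀ F : Finset (Clause Sg)) (M₁ : Assignment Sg) : Entry Sg → Prop
  | .dec => numDec M₁ ≤ numLit M₁
  | .lit l => l ∈ litUniverse F₀ ∧ l ∉ M₁.lits ∧ l.compl ∉ M₁.lits ∧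
      ((∃ M₀, M₁ = M₀ ++ [.dec]) ∨
        ∃ (ls : Finset (Literal Sg)) (i : Idx), (∀ x ∈ ls, x ∈ M₁.lits) ∧ Ent F ls l i)

theorem Ent.mono {F F' : Finset (Clause Sg)} (h : F ⊆ F') {ls : Finset (Literal Sg)}
    {l : Literal Sg} {i : Idx} (he : Ent F ls l i) : Ent F' ls l i := by
  cases i with
  | sat => exact h he
  | thy => exact he

/-- Learning only enlarges `F`, so reasons stay available for later explanations. -/
theorem Admissible.mono {F₀ F F' : Finset (Clause Sg)} (h : F ⊆ F') (M : Assignment Sg)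
    (e : Entry Sg) (he : Admissible F₀ F M e) : Admissible F₀ F' M e := by
  cases e with
  | dec => exact he
  | lit l =>
    obtain ⟨h₁, h₂, h₃, h₄⟩ := he
    exact ⟨h₁, h₂, h₃, h₄.imp_right fun ⟨ls, i, hls, hi⟩ => ⟨ls, i, hls, hi.mono h⟩⟩

section

variable {F₀ F : Finset (Clause Sg)} {M : Assignment Sg}

theorem mem_litUniverse_of_mem_lits (h : EachEntry (Admissible F₀ F) M) {l : Literal Sg}
    (hl : l ∈ M.lits) : l ∈ litUniverse F₀ := by
  obtain ⟨M₁, M₂, hM⟩ := exists_split_of_mem_lits hl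
  exact (h _ _ _ hM).1

/-- Each literal is new when it is added, so counting entries counts distinct literals. -/
theorem exists_card_eq_numLit (h : EachEntry (Admissible F₀ F) M) :
    ∃ X : Finset (Literal Sg), X.card = numLit M ∧ (X : Set (Literal Sg)) = M.lits := by
  induction M using List.reverseRecOn with
  | nil => exact ⟨∅, by simp [numLit, Assignment.lits]⟩
  | append_singleton M e ih =>
    obtain ⟨X, h₁, h₂⟩ := ih (h.of_prefix (List.prefix_append _ _))
    have he := h M e [] rfl
    cases e with
    | dec => exact ⟨X, by simpa [numLit] using h₁, by simp [h₂, Assignment.lits]⟩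
    | lit l =>
      have hl : l ∉ X := by
        rw [← Finset.mem_coe, h₂]
        exact he.2.1
      refine ⟨insert l X, by simp [hl, h₁, numLit], ?_⟩
      ext x
      rw [Finset.coe_insert, h₂, Assignment.mem_lits_concat, Set.mem_insert_iff, or_comm]

theorem numLit_le (h : EachEntry (Admissible F₀ F) M) :
    numLit M ≤ (finite_litUniverse F₀).toFinset.card := by
  obtain ⟨X, h₁, h₂⟩ := exists_card_eq_numLit h
  rw [← h₁]
  refine Finset.card_le_card fun x hx => ?_
  rw [Set.Finite.mem_toFinset]
  exact mem_litUniverse_of_mem_lits h (by rwa [← h₂])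

end

/-! ## The invariant of states -/

/-- The invariant of the states of an execution. -/
structure Invariant (F₀ : Finset (Clause Sg)) (s : State Sg) : Prop where
  input_subset : F₀ ⊆ s.F
  clause_subset : ∀ c ∈ s.F, ∀ l ∈ c, l ∈ litUniverse F₀
  entailed : ∀ I : Interp Sg, I.IsFCC → (∀ c ∈ F₀, I.SatClause c) → ∀ c ∈ s.F, I.SatClause c
  conf_entailed : ∀ I : Interp Sg, I.IsFCC → (∀ c ∈ F₀, I.SatClause c) →
    ∀ c, s.C = .clause c → I.SatClause c
  unsat_of_bot : s.C = .bot → ¬ FCCSatClauses F₀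
  conf_falsified : ∀ c, s.C = .clause c → ∀ x ∈ c, x.compl ∈ s.M.lits
  entries : EachEntry (Admissible F₀ s.F) s.M
  numDec_le : numDec s.M ≤ numLit s.M

namespace Invariant

variable {F₀ : Finset (Clause Sg)} {s s' : State Sg}

theorem litsF_subset (h : Invariant F₀ s) : litsF s.F ⊆ litUniverse F₀ := by
  rintro l ⟨c, hc, hl | hl⟩
  · exact h.clause_subset c hc l hl
  · simpa using compl_mem_litUniverse (h.clause_subset c hc _ hl)

theorem start (F₀ : Finset (Clause Sg)) : Invariant F₀ ⟨[], F₀, .no⟩ where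
  input_subset := subset_rfl
  clause_subset c hc l hl := Or.inl ⟨c, hc, Or.inl hl⟩
  entailed _ _ hF := hF
  conf_entailed := by simp
  unsat_of_bot := by simp
  conf_falsified := by simp
  entries M₁ e M₂ hM := by simp at hM
  numDec_le := le_rfl

theorem propagate {i : Idx} (h : Invariant F₀ s) (hC : s.C = .no) (hs : Propagate i s s') :
    Invariant F₀ s' := by
  obtain ⟨ls, l, hls, he, hl, hl₁, hl₂, rfl⟩ := hs
  exact {
    input_subset := h.input_subset
    clause_subset := h.clause_subset
    entailed := h.entailed
    conf_entailed := h.conf_entailed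
    unsat_of_bot := h.unsat_of_bot
    conf_falsified := by simp [hC]
    entries := h.entries.concat ⟨h.litsF_subset hl, hl₁, hl₂, Or.inr ⟨ls, i, hls, he⟩⟩
    numDec_le := by simpa [numDec, numLit] using h.numDec_le.trans (Nat.le_succ _) }

theorem decide (h : Invariant F₀ s) (hC : s.C = .no) (hs : Decide s s') : Invariant F₀ s' := by
  obtain ⟨l, hl, hl₁, hl₂, rfl⟩ := hs
  have hlits : Assignment.lits (s.M ++ [.dec]) = s.M.lits := by
    simp [Assignment.lits]
  refine {
    input_subset := h.input_subset
    clause_subset := h.clause_subset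
    entailed := h.entailed
    conf_entailed := h.conf_entailed
    unsat_of_bot := h.unsat_of_bot
    conf_falsified := by simp [hC]
    entries := ?_
    numDec_le := by simpa [numDec, numLit] using h.numDec_le }
  have := (h.entries.concat (e := .dec) h.numDec_le).concat (e := .lit l)
    ⟨h.litsF_subset hl, by rwa [hlits], by rwa [hlits], Or.inl ⟨_, rfl⟩⟩
  simpa using this

theorem conflict {i : Idx} {ls : Finset (Literal Sg)} (h : Invariant F₀ s)
    (hs : Conflict i ls s s') : Invariant F₀ s' := by
  obtain ⟨hC, hls, he, rfl⟩ := hs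
  refine {
    input_subset := h.input_subset
    clause_subset := h.clause_subset
    entailed := h.entailed
    conf_entailed := ?_
    unsat_of_bot := by simp
    conf_falsified := ?_
    entries := h.entries
    numDec_le := h.numDec_le }
  · rintro I hI hF c ⟨⟩
    cases i with
    | sat => exact h.entailed I hI hF _ he
    | thy =>
      by_contra hc
      refine he ⟨I, hI, fun x hx => ?_⟩
      by_contra hx'
      exact hc ⟨x.compl, Finset.mem_image_of_mem _ hx, by simpa using hx'⟩
  · rintro c ⟨⟩ x hx
    exact hls _ (mem_image_compl.1 hx)

/-- The new conflict clause is the resolvent on `l` of the old one with the reason of `l.compl`; its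
new literals are falsified because their complements precede `l.compl` in `M`. -/
theorem explain {i : Idx} (h : Invariant F₀ s) (hs : Explain i s s') : Invariant F₀ s' := by
  obtain ⟨l, D, ls, hl, hC, he, hb, rfl⟩ := hs
  refine {
    input_subset := h.input_subset
    clause_subset := h.clause_subset
    entailed := h.entailed
    conf_entailed := ?_
    unsat_of_bot := by simp
    conf_falsified := ?_
    entries := h.entries
    numDec_le := h.numDec_le }
  · rintro I hI hF c ⟨⟩
    obtain ⟨x, hx, hsat⟩ := h.conf_entailed I hI hF _ hC
    rcases Finset.mem_insert.1 hx with rfl | hx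
    · by_contra hc
      have hls : ∀ y ∈ ls, ¬ I.SatLit y := fun y hy hy' =>
        hc ⟨y, Finset.mem_union_left _ hy, hy'⟩
      cases i with
      | sat =>
        have he' : insert x.compl ls ∈ s.F := by simpa [Ent] using he
        obtain ⟨y, hy, hy'⟩ := h.entailed I hI hF _ he'
        rcases Finset.mem_insert.1 hy with rfl | hy
        · exact (I.satLit_compl x).1 hy' hsat
        · exact hls y hy hy'
      | thy =>
        refine (I.satLit_compl x).1 (he I hI fun y hy => ?_) hsat
        have := hls _ (mem_image_compl.1 hy)
        simpa using this
    · exact ⟨x, Finset.mem_union_right _ hx, hsat⟩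
  · rintro c ⟨⟩ x hx
    rcases Finset.mem_union.1 hx with hx | hx
    · obtain ⟨M₁, M₂, M₃, hM⟩ := hb x hx
      simp [hM, Assignment.lits]
    · exact h.conf_falsified _ hC x (Finset.mem_insert_of_mem hx)

theorem learn {c : Clause Sg} (h : Invariant F₀ s)
    (hc : ∀ I : Interp Sg, I.IsFCC → (∀ c ∈ F₀, I.SatClause c) → I.SatClause c)
    (hU : ∀ l ∈ c, l ∈ litUniverse F₀) : Invariant F₀ { s with F := insert c s.F } where
  input_subset := h.input_subset.trans (Finset.subset_insert _ _)
  clause_subset c' hc' := by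
    rcases Finset.mem_insert.1 hc' with rfl | hc'
    · exact hU
    · exact h.clause_subset c' hc'
  entailed I hI hF c' hc' := by
    rcases Finset.mem_insert.1 hc' with rfl | hc'
    · exact hc I hI hF
    · exact h.entailed I hI hF c' hc'
  conf_entailed := h.conf_entailed
  unsat_of_bot := h.unsat_of_bot
  conf_falsified := h.conf_falsified
  entries := h.entries.mono fun M e => Admissible.mono (Finset.subset_insert _ _) M e
  numDec_le := h.numDec_le

theorem learnThy {c : Clause Sg} (h : Invariant F₀ s) (hs : LearnThy (learnable F₀) c s s') :
    Invariant F₀ s' := by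
  obtain ⟨hc, hL, rfl⟩ := hs
  refine h.learn (fun I hI _ => hc I hI) fun l hl => ?_
  rcases hL l hl with (hl | hl) | hl
  · exact mem_litUniverse_of_mem_lits h.entries hl
  · simpa using compl_mem_litUniverse (mem_litUniverse_of_mem_lits h.entries hl)
  · exact Or.inr hl

theorem learnSat (h : Invariant F₀ s) (hs : LearnSat s s') : Invariant F₀ s' := by
  obtain ⟨c, hC, _, rfl⟩ := hs
  refine h.learn (fun I hI hF => h.conf_entailed I hI hF c hC) fun l hl => ?_
  simpa using compl_mem_litUniverse
    (mem_litUniverse_of_mem_lits h.entries (h.conf_falsified c hC l hl))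

theorem weakFalse (h : Invariant F₀ s) (hs : WeakFalse F₀ s s') : Invariant F₀ s' := by
  cases hs with
  | cong ls _ h' => exact h.conflict h'
  | card k j _ _ h' => exact h.conflict h'
  | clique k t _ _ _ h' => exact h.learnThy h'

theorem strongFalse (h : Invariant F₀ s) (hs : StrongFalse F₀ s s') : Invariant F₀ s' := by
  obtain ⟨_, _, _, _, _, _, _, _, _, _, h'⟩ := hs
  exact h.learnThy h'

theorem fail (h : Invariant F₀ s) (hs : s.C = .clause ∅) : Invariant F₀ { s with C := .bot } where
  input_subset := h.input_subset
  clause_subset := h.clause_subset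
  entailed := h.entailed
  conf_entailed := by simp
  unsat_of_bot _ := by
    rintro ⟨I, hI, hF⟩
    obtain ⟨l, hl, -⟩ := h.conf_entailed I hI hF ∅ hs
    simp at hl
  conf_falsified := by simp
  entries := h.entries
  numDec_le := h.numDec_le

theorem prefix_of_numDec_lt {A B M : Assignment Sg} (hA : A <+: M) (hB : B <+: M)
    (h : numDec A < numDec B) : A <+: B := by
  rcases List.prefix_or_prefix_of_prefix hA hB with h' | ⟨R, rfl⟩
  · exact h'
  · simp at h

/-- The shape of the assignment before a backjump to the level `i`. -/
theorem backjump_split (h : Invariant F₀ s) {l : Literal Sg} {i j : ℕ} (hij : i < j)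
    (hl : HasLev s.M l.compl j) :
    ∃ R, s.M = upToLev i s.M ++ .dec :: R ∧ numDec (upToLev i s.M) = i ∧
      i ≤ numLit (upToLev i s.M) ∧
      l ∈ litUniverse F₀ ∧ l ∉ (upToLev i s.M).lits ∧ l.compl ∉ (upToLev i s.M).lits := by
  obtain ⟨M₁, M₂, hM, rfl⟩ := hl
  have hi : i < numDec s.M := by rw [hM, numDec_append]; omega
  obtain ⟨R, hR, hnum⟩ := upToLev_split hi
  -- The entry after this prefix is a decision point, for which `Admissible` gives the bound. It
  -- later keeps the exponents of the weight from being truncated.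
  have hle : numDec (upToLev i s.M) ≤ numLit (upToLev i s.M) := h.entries _ _ _ hR
  -- The kept prefix ends before `l.compl`; as `l.compl` and `l` were both unassigned when `l.compl`
  -- was added, both are unassigned in it.
  have hpre : upToLev i s.M <+: M₁ := prefix_of_numDec_lt (M := s.M)
    ⟨_, hR.symm⟩ ⟨_, hM.symm⟩ (by omega)
  obtain ⟨h₁, h₂, h₃, -⟩ := h.entries _ _ _ hM
  rw [Literal.compl_compl] at h₃
  exact ⟨R, hR, hnum, by omega, by simpa using compl_mem_litUniverse h₁,
    fun h' => h₃ (lits_of_prefix hpre h'), fun h' => h₂ (lits_of_prefix hpre h')⟩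

theorem backjump (h : Invariant F₀ s) (hF : ∀ c, s.C = .clause c → c ∈ s.F)
    (hs : Backjump s s') : Invariant F₀ s' := by
  obtain ⟨l, D, i, hl, hC, hD, ⟨j, hij, hj⟩, rfl⟩ := hs
  obtain ⟨R, hR, hnum, hle, hU, h₁, h₂⟩ := h.backjump_split hij hj
  refine {
    input_subset := h.input_subset
    clause_subset := h.clause_subset
    entailed := h.entailed
    conf_entailed := by simp
    unsat_of_bot := by simp
    conf_falsified := by simp
    entries := ?_
    numDec_le := by
      simp only [numDec_append, numLit_append, hnum, numDec, numLit]
      omega }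
  -- The conflict clause, just learned, is the reason of `l`: the complements of `D` survive in the
  -- prefix.
  refine (h.entries.of_prefix ⟨_, hR.symm⟩).concat
    ⟨hU, h₁, h₂, Or.inr ⟨D.image Literal.compl, .sat, fun x hx => ?_, ?_⟩⟩
  · obtain ⟨j', hj', hlev⟩ := hD _ (mem_image_compl.1 hx)
    simpa using mem_lits_upToLev hlev hj'
  · simpa [Ent] using hF _ hC

theorem learnBackjump {s₁ : State Sg} (h : Invariant F₀ s) (h₁ : LearnSat s s₁)
    (h₂ : Backjump s₁ s') : Invariant F₀ s' := by
  refine (h.learnSat h₁).backjump (fun c hc => ?_) h₂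
  obtain ⟨c', hC, _, rfl⟩ := h₁
  obtain rfl : c' = c := by simpa [hC] using hc
  exact Finset.mem_insert_self _ _

end Invariant

/-! ## The invariant of configurations -/

/-- The invariant of the configurations of an execution. -/
structure ConfigInvariant (F₀ : Finset (Clause Sg)) (c : Config Sg) : Prop where
  state : Invariant F₀ c.st
  no_of_check : c.loc = .check → c.st.C = .no
  ne_bot_of_conflict : c.loc = .conflict → c.st.C ≠ .bot
  of_returned : c.loc = .returned → c.st.C = .bot ∨ (c.st.C = .no ∧ WeakTrue c.st ∧
    AllAssigned c.st ∧ (∀ ls s, ¬ Conflict .sat ls c.st s) ∧ StrongTrue c.st)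

theorem Conflict.conf_eq {i : Idx} {ls : Finset (Literal Sg)} {s s' : State Sg}
    (h : Conflict i ls s s') : s' = { s with C := .clause (ls.image Literal.compl) } :=
  h.2.2.2

theorem WeakFalse.conflicts_or_learns {F₀ : Finset (Clause Sg)} {s s' : State Sg} (h : WeakFalse F₀ s s') :
    (∃ c, s' = { s with C := .clause c }) ∨ ∃ c, c ∉ s.F ∧ s' = { s with F := insert c s.F } := by
  cases h with
  | cong ls _ h' => exact Or.inl ⟨_, h'.conf_eq⟩
  | card k j _ _ h' => exact Or.inl ⟨_, h'.conf_eq⟩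
  | clique k t _ _ h'' h' => exact Or.inr ⟨_, h''.2.2.2, h'.2.2⟩

/-- The splitting lemma of the strong effort check is new. -/
theorem StrongFalse.learns {F₀ : Finset (Clause Sg)} {s s' : State Sg} (ha : AllAssigned s)
    (h : StrongFalse F₀ s s') : ∃ c, c ∉ s.F ∧ s' = { s with F := insert c s.F } := by
  obtain ⟨k, n, t, i, j, -, hr, -, hij, hne, -, -, rfl⟩ := h
  refine ⟨_, fun hc => ?_, rfl⟩
  -- If the lemma were in `F`, its atom would be assigned: positively, it merges two distinct
  -- classes; negatively, the disequality is entailed.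
  rcases ha (.pos (.eq (t i) (t j))) ⟨_, hc, Or.inl (by simp)⟩ with h | h
  · exact hr.not_entails_eq hij.ne fun I hI => hI _ h
  · exact hne fun I hI => hI _ h

theorem ConfigInvariant.step {F₀ : Finset (Clause Sg)} {c c' : Config Sg}
    (h : ConfigInvariant F₀ c) (hs : Step F₀ c c') : ConfigInvariant F₀ c' := by
  have hst := h.state
  cases hs with
  | propagate i s s' hp =>
    have hC := h.no_of_check rfl
    refine ⟨hst.propagate hC hp, fun _ => ?_, by simp, by simp⟩
    obtain ⟨_, _, _, _, _, _, _, rfl⟩ := hp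
    exact hC
  | satConflict ls s s' hc =>
    exact ⟨hst.conflict hc, by simp, by simp [hc.conf_eq], by simp⟩
  | weakFalse s s' hw =>
    have hC : s.C = .no := h.no_of_check rfl
    refine ⟨hst.weakFalse hw, by simp, fun _ => ?_, by simp⟩
    rcases hw.conflicts_or_learns with ⟨c, rfl⟩ | ⟨c, -, rfl⟩
    · simp
    · simp [hC]
  | decide s s' _ hd =>
    have hC : s.C = .no := h.no_of_check rfl
    refine ⟨hst.decide hC hd, by simp, fun _ => ?_, by simp⟩
    obtain ⟨_, _, _, _, rfl⟩ := hd
    simp [hC]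
  | strongFalse s s' _ ha _ hf =>
    have hC : s.C = .no := h.no_of_check rfl
    refine ⟨hst.strongFalse hf, by simp, fun _ => ?_, by simp⟩
    obtain ⟨c, -, rfl⟩ := hf.learns ha
    simp [hC]
  | strongTrue s hw ha hn ht =>
    exact ⟨hst, by simp, by simp, fun _ => Or.inr ⟨h.no_of_check rfl, hw, ha, hn, ht⟩⟩
  | noConflict s hC => exact ⟨hst, fun _ => hC, by simp, by simp⟩
  | explain i s s' he =>
    refine ⟨hst.explain he, by simp, fun _ => ?_, by simp⟩
    obtain ⟨_, _, _, _, _, _, _, rfl⟩ := he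
    simp
  | fail s hC => exact ⟨hst.fail hC, by simp, by simp, fun _ => Or.inl rfl⟩
  | learnBackjump s s₁ s' hl hb =>
    refine ⟨hst.learnBackjump hl hb, fun _ => ?_, by simp, by simp⟩
    obtain ⟨_, _, _, _, _, _, _, rfl⟩ := hb
    rfl

theorem Reachable.configInvariant {F₀ : Finset (Clause Sg)} {c : Config Sg}
    (h : Reachable F₀ c) : ConfigInvariant F₀ c := by
  induction h with
  | refl => exact ⟨Invariant.start F₀, fun _ => rfl, by simp [init], by simp [init]⟩
  | tail _ hs ih => exact ih.step hs

theorem sound (F₀ : Finset (Clause Sg)) : Sound F₀ :=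
  fun _ hc => hc.configInvariant.state.unsat_of_bot

/-! ## Termination -/

/-- The weight of an assignment: each literal at level `j` counts `B ^ (e - j)`. -/
def levWeight (B : ℕ) : ℕ → Assignment Sg → ℕ
  | _, [] => 0
  | e, .lit _ :: M => B ^ e + levWeight B e M
  | e, .dec :: M => levWeight B (e - 1) M

theorem levWeight_append (B e : ℕ) (M N : Assignment Sg) :
    levWeight B e (M ++ N) = levWeight B e M + levWeight B (e - numDec M) N := by
  induction M generalizing e with
  | nil => simp [levWeight, numDec]
  | cons x M ih =>
    cases x with
    | dec => simp [levWeight, numDec, ih, Nat.sub_sub, Nat.add_comm]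
    | lit l => simp [levWeight, numDec, ih, Nat.add_assoc]

theorem levWeight_le {B : ℕ} (hB : 0 < B) (e : ℕ) (M : Assignment Sg) :
    levWeight B e M ≤ numLit M * B ^ e := by
  induction M generalizing e with
  | nil => simp [levWeight]
  | cons x M ih =>
    cases x with
    | dec =>
      exact (ih (e - 1)).trans (Nat.mul_le_mul_left _ (Nat.pow_le_pow_right hB (Nat.sub_le _ _)))
    | lit l =>
      have := ih e
      simp only [levWeight, numLit, Nat.add_mul, Nat.one_mul]
      omega

/-- The value of the set of positions in `M` of the complements of `c`, as a binary number. -/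
noncomputable def posValue (c : Clause Sg) : Assignment Sg → ℕ
  | [] => 0
  | .dec :: M => 2 * posValue c M
  | .lit l :: M => (if l.compl ∈ c then 1 else 0) + 2 * posValue c M

theorem posValue_append (c : Clause Sg) (M N : Assignment Sg) :
    posValue c (M ++ N) = posValue c M + 2 ^ M.length * posValue c N := by
  induction M with
  | nil => simp [posValue]
  | cons x M ih => cases x <;> simp [posValue, ih, pow_succ] <;> ring

theorem posValue_lt (c : Clause Sg) (M : Assignment Sg) : posValue c M < 2 ^ M.length := by
  induction M with
  | nil => simp [posValue]
  | cons x M ih =>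
    cases x with
    | dec => simp only [posValue, List.length_cons, pow_succ]; omega
    | lit l => simp only [posValue, List.length_cons, pow_succ]; split_ifs <;> omega

theorem posValue_mono {c c' : Clause Sg} {M : Assignment Sg}
    (h : ∀ l ∈ M.lits, l.compl ∈ c → l.compl ∈ c') : posValue c M ≤ posValue c' M := by
  induction M with
  | nil => rfl
  | cons x M ih =>
    have ih := ih fun l hl => h l (List.mem_cons_of_mem _ hl)
    cases x with
    | dec => simp only [posValue]; omega
    | lit l =>
      have := h l List.mem_cons_self
      simp only [posValue]
      split_ifs <;> first | omega | exact absurd (this ‹_›) ‹_›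

/-- Older entries are less significant bits. Explain clears the bit at the position of `l.compl` and
sets bits only at earlier positions, so the number drops. -/
theorem Explain.posValue_lt {F₀ : Finset (Clause Sg)} {i : Idx} {s s' : State Sg}
    (h : Invariant F₀ s) (hs : Explain i s s') :
    ∃ c c', s.C = .clause c ∧ s' = { s with C := .clause c' } ∧
      posValue c' s.M < posValue c s.M := by
  obtain ⟨l, D, ls, hl, hC, -, hb, rfl⟩ := hs
  refine ⟨_, _, hC, rfl, ?_⟩
  have hmem := h.conf_falsified _ hC l (Finset.mem_insert_self _ _)
  obtain ⟨A, R, hM⟩ := exists_split_of_mem_lits hmem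
  have hA : ∀ x ∈ ls, x.compl ∈ A.lits ∧ x.compl ∉ R.lits ∧ x ≠ l := by
    intro x hx
    obtain ⟨M₁, M₂, M₃, hM'⟩ := hb x hx
    have fresh : ∀ {B₁ B₂ : Assignment Sg} {y : Literal Sg}, s.M = B₁ ++ .lit y :: B₂ →
        y ∉ B₁.lits := fun h' => (h.entries _ _ _ h').2.1
    have hM'' : s.M = (M₁ ++ .lit x.compl :: M₂) ++ .lit l.compl :: M₃ := by simpa using hM'
    have hx₁ : x.compl ∈ Assignment.lits (M₁ ++ .lit x.compl :: M₂) := by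
      simp [Assignment.lits]
    have hne : x ≠ l := by
      rintro rfl
      exact fresh hM'' hx₁
    -- Both splits of `M` are at `l.compl`, which occurs only once.
    have hpre : M₁ ++ .lit x.compl :: M₂ = A := by
      rcases List.append_eq_append_iff.1 (hM''.symm.trans hM) with ⟨X, hX, hX'⟩ | ⟨X, hX, hX'⟩
      · cases X with
        | nil => simpa using hX.symm
        | cons e X =>
          simp only [List.cons_append, List.cons.injEq] at hX'
          refine absurd ?_ (fresh hM)
          rw [hX, ← hX'.1]
          simp [Assignment.lits]
      · cases X with
        | nil => simpa using hX
        | cons e X =>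
          simp only [List.cons_append, List.cons.injEq] at hX'
          refine absurd ?_ (fresh hM'')
          rw [hX, ← hX'.1]
          simp [Assignment.lits]
    rw [hpre] at hx₁
    refine ⟨hx₁, fun hR => ?_, hne⟩
    obtain ⟨R₁, R₂, rfl⟩ := exists_split_of_mem_lits hR
    refine fresh (B₁ := A ++ .lit l.compl :: R₁) (B₂ := R₂) (by simpa using hM) ?_
    simpa [Assignment.lits] using Or.inl hx₁
  have hl' : l ∉ ls ∪ D := by
    rw [Finset.mem_union]
    rintro (h' | h')
    · exact (hA l h').2.2 rfl
    · exact hl h'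
  have hR : posValue (ls ∪ D) R ≤ posValue (insert l D) R := by
    refine posValue_mono fun y hy hy' => ?_
    rcases Finset.mem_union.1 hy' with h' | h'
    · exact absurd (by simpa using hy) (hA _ h').2.1
    · exact Finset.mem_insert_of_mem h'
  have h₁ := FCC.posValue_lt (ls ∪ D) A
  have h₂ := Nat.mul_le_mul_left (2 ^ A.length) hR
  -- The bits below the cleared one total less than `2 ^ A.length`, and those above do not grow.
  simp only [hM, posValue_append, posValue, Literal.compl_compl, if_neg hl',
    if_pos (Finset.mem_insert_self l D), Nat.mul_add, Nat.mul_left_comm _ 2]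
  omega

/-- The progress of a state: it grows with the assignment and with the clause set. -/
noncomputable def progress (F₀ : Finset (Clause Sg)) (s : State Sg) : ℕ :=
  levWeight ((finite_litUniverse F₀).toFinset.card + 1)
    ((finite_litUniverse F₀).toFinset.card + 1) s.M + s.F.card

/-- An upper bound of the progress. -/
noncomputable def maxProgress (F₀ : Finset (Clause Sg)) : ℕ :=
  (finite_litUniverse F₀).toFinset.card * ((finite_litUniverse F₀).toFinset.card + 1) ^
    ((finite_litUniverse F₀).toFinset.card + 1) + 2 ^ (finite_litUniverse F₀).toFinset.card

theorem Invariant.progress_le {F₀ : Finset (Clause Sg)} {s : State Sg} (h : Invariant F₀ s) :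
    progress F₀ s ≤ maxProgress F₀ := by
  refine Nat.add_le_add ((levWeight_le (Nat.succ_pos _) _ _).trans
    (Nat.mul_le_mul_right _ (numLit_le h.entries))) ?_
  rw [← Finset.card_powerset]
  refine Finset.card_le_card fun c hc => Finset.mem_powerset.2 fun l hl => ?_
  rw [Set.Finite.mem_toFinset]
  exact h.clause_subset c hc l hl

theorem progress_lt_of_learn {F₀ : Finset (Clause Sg)} {s : State Sg} {c : Clause Sg}
    (hc : c ∉ s.F) : progress F₀ s < progress F₀ { s with F := insert c s.F } := by
  simp [progress, Finset.card_insert_of_notMem hc]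

theorem Propagate.progress_lt {F₀ : Finset (Clause Sg)} {i : Idx} {s s' : State Sg}
    (hs : Propagate i s s') : progress F₀ s < progress F₀ s' := by
  obtain ⟨_, _, _, _, _, _, _, rfl⟩ := hs
  simp [progress, levWeight_append, levWeight]

theorem Decide.progress_lt {F₀ : Finset (Clause Sg)} {s s' : State Sg}
    (hs : Decide s s') : progress F₀ s < progress F₀ s' := by
  obtain ⟨_, _, _, _, rfl⟩ := hs
  simp [progress, levWeight_append, levWeight]

theorem Invariant.progress_lt_of_backjump {F₀ : Finset (Clause Sg)} {s s' : State Sg}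
    (h : Invariant F₀ s) (hs : Backjump s s') : progress F₀ s < progress F₀ s' := by
  obtain ⟨l, D, i, -, -, -, ⟨j, hij, hj⟩, rfl⟩ := hs
  obtain ⟨R, hR, hnum, hle, -⟩ := h.backjump_split hij hj
  set P := upToLev i s.M
  have hK := numLit_le h.entries
  set K := (finite_litUniverse F₀).toFinset.card with hKdef
  have hPR : numLit P + numLit R ≤ K := by
    rw [hR] at hK
    simpa [numLit] using hK
  have hw : levWeight (K + 1) (K + 1) s.M =
      levWeight (K + 1) (K + 1) P + levWeight (K + 1) (K - i) R := by
    rw [hR, levWeight_append, hnum, levWeight]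
    congr 2
    omega
  -- `R` has at most `K` literals, each weighing at most `(K + 1) ^ (K - i)`: together less than one
  -- literal at level `i`. The exponent identity below needs `i ≤ K`.
  have hlt : levWeight (K + 1) (K - i) R < (K + 1) ^ (K + 1 - i) := by
    refine (levWeight_le (Nat.succ_pos _) _ _).trans_lt ?_
    rw [show K + 1 - i = (K - i) + 1 by omega, pow_succ, mul_comm]
    exact Nat.mul_lt_mul_of_pos_left (by omega) (by positivity)
  simp only [progress, ← hKdef, levWeight_append, hnum, levWeight]
  omega

theorem Invariant.progress_lt_of_learnBackjump {F₀ : Finset (Clause Sg)} {s s₁ s' : State Sg}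
    (h : Invariant F₀ s) (h₁ : LearnSat s s₁) (h₂ : Backjump s₁ s') :
    progress F₀ s < progress F₀ s' := by
  refine lt_of_le_of_lt ?_ ((h.learnSat h₁).progress_lt_of_backjump h₂)
  obtain ⟨c, _, _, rfl⟩ := h₁
  exact Nat.add_le_add_left (Finset.card_le_card (Finset.subset_insert _ _)) _

/-- The rank of a configuration, which decreases in the steps that make no progress. -/
noncomputable def Config.rank : Config Sg → ℕ
  -- For a fixed `M` the ranks decrease from `conflict` without a clause, through `check` and
  -- `conflict` with a clause (at most `2 ^ s.M.length`), to `returned`.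
  | ⟨.check, s⟩ => 2 ^ s.M.length + 1
  | ⟨.returned, _⟩ => 0
  | ⟨.conflict, ⟨M, _, .clause c⟩⟩ => posValue c M + 1
  | ⟨.conflict, ⟨M, _, _⟩⟩ => 2 ^ M.length + 2

/-- The termination measure. -/
noncomputable def Config.measure (F₀ : Finset (Clause Sg)) (c : Config Sg) : ℕ ×ₗ ℕ :=
  toLex (maxProgress F₀ - progress F₀ c.st, c.rank)

theorem Config.measure_lt_of_progress {F₀ : Finset (Clause Sg)} {c c' : Config Sg}
    (h : Invariant F₀ c'.st) (hlt : progress F₀ c.st < progress F₀ c'.st) :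
    c'.measure F₀ < c.measure F₀ := by
  have := h.progress_le
  exact Prod.Lex.toLex_lt_toLex.2 (Or.inl (by dsimp only; omega))

theorem Config.measure_lt_of_rank {F₀ : Finset (Clause Sg)} {c c' : Config Sg}
    (h : progress F₀ c'.st = progress F₀ c.st) (hlt : c'.rank < c.rank) :
    c'.measure F₀ < c.measure F₀ :=
  Prod.Lex.toLex_lt_toLex.2 (Or.inr ⟨by dsimp only; rw [h], hlt⟩)

theorem Config.measure_conflict_lt (F₀ : Finset (Clause Sg)) (s : State Sg) (c : Clause Sg) :
    (Config.mk .conflict { s with C := .clause c }).measure F₀ <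
      (Config.mk .check s).measure F₀ :=
  measure_lt_of_rank rfl (Nat.succ_lt_succ (posValue_lt c s.M))

theorem ConfigInvariant.measure_lt {F₀ : Finset (Clause Sg)} {c c' : Config Sg}
    (h : ConfigInvariant F₀ c) (hs : Step F₀ c c') : c'.measure F₀ < c.measure F₀ := by
  have h' := (h.step hs).state
  cases hs with
  | propagate i s s' hp => exact Config.measure_lt_of_progress h' hp.progress_lt
  | satConflict ls s s' hc =>
    rw [hc.conf_eq]
    exact Config.measure_conflict_lt F₀ s _
  | weakFalse s s' hw =>
    rcases hw.conflicts_or_learns with ⟨c, rfl⟩ | ⟨c, hc, rfl⟩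
    · exact Config.measure_conflict_lt F₀ s c
    · exact Config.measure_lt_of_progress h' (progress_lt_of_learn hc)
  | decide s s' _ hd => exact Config.measure_lt_of_progress h' hd.progress_lt
  | strongFalse s s' _ ha _ hf =>
    obtain ⟨c, hc, rfl⟩ := hf.learns ha
    exact Config.measure_lt_of_progress h' (progress_lt_of_learn hc)
  | strongTrue s => exact Config.measure_lt_of_rank rfl (Nat.succ_pos _)
  | noConflict s hC =>
    obtain ⟨M, F, C⟩ := s
    obtain rfl : C = .no := hC
    exact Config.measure_lt_of_rank rfl (Nat.lt_succ_self _)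
  | explain i s s' he =>
    obtain ⟨c, c', hC, rfl, hlt⟩ := he.posValue_lt h.state
    obtain ⟨M, F, C⟩ := s
    obtain rfl : C = .clause c := hC
    exact Config.measure_lt_of_rank rfl (Nat.succ_lt_succ hlt)
  | fail s hC =>
    obtain ⟨M, F, C⟩ := s
    obtain rfl : C = .clause ∅ := hC
    exact Config.measure_lt_of_rank rfl (Nat.succ_pos _)
  | learnBackjump s s₁ s' h₁ h₂ =>
    exact Config.measure_lt_of_progress h' (h.state.progress_lt_of_learnBackjump h₁ h₂)

theorem terminating (F₀ : Finset (Clause Sg)) : Terminating F₀ := by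
  rintro ⟨r, h₀, hr⟩
  have hreach : ∀ n, Reachable F₀ (r n) := fun n => by
    induction n with
    | zero => rw [h₀]; exact .refl
    | succ n ih => exact .tail ih (hr n)
  exact not_strictAnti_of_wellFoundedLT (fun n => (r n).measure F₀)
    (strictAnti_nat_of_succ_lt fun n => (hreach n).configInvariant.measure_lt (hr n))

/-! ## Completeness -/

theorem HasCongConflict.of_eufUnsat {s : State Sg} (h : EUFUnsat s.M.lits) :
    HasCongConflict s :=
  ⟨(finite_lits s.M).toFinset, fun x hx => by simpa using hx, by simpa using h⟩

theorem termOf_of_lits {F₀ : Finset (Clause Sg)} {s : State Sg} (h : Invariant F₀ s) {σ : Srt}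
    {t : Term Sg σ} (ht : TermOf s.M.lits t) : TermOf (litsF F₀) t :=
  termOf_litsF_of_litUniverse (ht.mono fun _ => mem_litUniverse_of_mem_lits h.entries)

/-- If the weak effort check does not return `true`, it applies a rule. -/
theorem exists_weakFalse {F₀ : Finset (Clause Sg)} {s : State Sg} (h : Invariant F₀ s)
    (hC : s.C = .no) (hw : ¬ WeakTrue s) : ∃ s', WeakFalse F₀ s s' := by
  by_cases h₁ : HasCongConflict s
  · obtain ⟨ls, hls, hu⟩ := h₁
    exact ⟨_, .cong ls hu ⟨hC, hls, not_fccSat_of_eufUnsat hu, rfl⟩⟩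
  by_cases h₂ : HasCardConflict s
  · obtain ⟨k, j, hkj⟩ := h₂
    refine ⟨_, .card k j h₁ hkj ⟨hC, fun x hx => ?_, not_fccSat_card hkj.2.2, rfl⟩⟩
    rw [Finset.mem_insert, Finset.mem_singleton] at hx
    rcases hx with rfl | rfl
    · exact hkj.1
    · exact hkj.2.1
  by_cases h₃ : HasClique s
  · obtain ⟨k, t, hkt⟩ := h₃
    refine ⟨_, .clique k t h₁ h₂ hkt ⟨fccValid_cliqueLemma k t, fun l hl => ?_, rfl⟩⟩
    rcases Finset.mem_insert.1 hl with rfl | hl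
    · exact Or.inl (Or.inr hkt.1)
    · obtain ⟨p, -, rfl⟩ := Finset.mem_image.1 hl
      exact Or.inr ⟨_, _, termOf_of_lits h (hkt.2.1 _), termOf_of_lits h (hkt.2.1 _), rfl⟩
  exact absurd ⟨h₁, h₂, h₃⟩ hw

/-- If all literals are assigned and no clause is falsified, each clause contains a true literal. -/
theorem exists_mem_lits {s : State Sg} (hC : s.C = .no) (ha : AllAssigned s)
    (hn : ∀ ls s', ¬ Conflict .sat ls s s') {c : Clause Sg} (hc : c ∈ s.F) :
    ∃ l ∈ c, l ∈ s.M.lits := by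
  by_contra! hcon
  refine hn (c.image Literal.compl) _ ⟨hC, fun x hx => ?_, ?_, rfl⟩
  · rw [mem_image_compl] at hx
    simpa [hcon _ hx] using ha _ ⟨c, hc, Or.inl hx⟩
  · simpa [EntBot] using hc

/-- If the strong effort check is run, it returns a result. -/
theorem strongTrue_or_exists_strongFalse {F₀ : Finset (Clause Sg)} {s : State Sg}
    (h : Invariant F₀ s) (hC : s.C = .no) (hw : WeakTrue s) (ha : AllAssigned s)
    (hn : ∀ ls s', ¬ Conflict .sat ls s s') : StrongTrue s ∨ ∃ s', StrongFalse F₀ s s' := by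
  by_cases hcard : ∀ k : ℕ+, Literal.pos (.card k) ∉ s.M.lits
  · exact Or.inl (Or.inl hcard)
  push Not at hcard
  obtain ⟨k, hk⟩ : ∃ k, IsMinCard s.M k :=
    ⟨_, WellFounded.min_mem wellFounded_lt {k : ℕ+ | Literal.pos (.card k) ∈ s.M.lits} hcard,
      fun j hj => WellFounded.min_le wellFounded_lt hj⟩
  obtain ⟨n, t, ht⟩ := exists_isReps (finite_lits s.M)
  rcases le_or_gt n (k : ℕ) with hle | hlt
  · exact Or.inl (Or.inr ⟨k, n, t, hk, ht, hle⟩)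
  by_cases hd : EntailsDistinct s.M.lits t
  · exfalso
    -- The first `k + 1` representatives form a clique. The weak check returned `true`, so its lemma
    -- is in `F` and has a literal in `M`; each of its literals contradicts an EUF-model of `M`.
    let t' : Fin ((k : ℕ) + 1) → Term Sg Srt.S := fun i => t (Fin.castLE hlt i)
    have hd' : EntailsDistinct s.M.lits t' := fun i j hij => hd _ _ (by simpa using hij)
    have hmem : cliqueLemma k t' ∈ s.F := by
      by_contra hmem
      exact hw.2.2 ⟨k, t', hk.1, fun i => ht.1 _, hd', hmem⟩
    obtain ⟨I, hI⟩ := not_forall_not.1 fun hu => hw.1 (.of_eufUnsat hu)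
    obtain ⟨l, hl, hlM⟩ := exists_mem_lits hC ha hn hmem
    rcases Finset.mem_insert.1 hl with rfl | hl
    · exact hI _ hlM (hI _ hk.1)
    · obtain ⟨p, hp, rfl⟩ := Finset.mem_image.1 hl
      exact hd' p.1 p.2 (Finset.mem_filter.1 hp).2 I hI (hI _ hlM)
  · simp only [EntailsDistinct, not_forall] at hd
    obtain ⟨i, j, hij, hne⟩ := hd
    refine Or.inr ⟨_, k, n, t, i, j, hk, ht, hlt, hij, hne, fccValid_split _, fun l hl => ?_, rfl⟩
    rw [Finset.mem_insert, Finset.mem_singleton] at hl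
    refine Or.inr ⟨_, _, termOf_of_lits h (ht.1 i), termOf_of_lits h (ht.1 j), ?_⟩
    rcases hl with rfl | rfl <;> rfl

theorem exists_step_check {F₀ : Finset (Clause Sg)} {s : State Sg} (h : Invariant F₀ s)
    (hC : s.C = .no) : ∃ c', Step F₀ ⟨.check, s⟩ c' := by
  by_cases hw : WeakTrue s
  swap
  · obtain ⟨s', h'⟩ := exists_weakFalse h hC hw
    exact ⟨_, .weakFalse s s' h'⟩
  by_cases ha : AllAssigned s
  swap
  · simp only [AllAssigned, not_forall, not_or] at ha
    obtain ⟨l, hl, h₁, h₂⟩ := ha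
    exact ⟨_, .decide s _ hw ⟨l, hl, h₁, h₂, rfl⟩⟩
  by_cases hn : ∀ ls s', ¬ Conflict .sat ls s s'
  swap
  · push Not at hn
    obtain ⟨ls, s', h'⟩ := hn
    exact ⟨_, .satConflict ls s s' h'⟩
  rcases strongTrue_or_exists_strongFalse h hC hw ha hn with ht | ⟨s', h'⟩
  · exact ⟨_, .strongTrue s hw ha hn ht⟩
  · exact ⟨_, .strongFalse s s' hw ha hn h'⟩

/-- A nonempty conflict clause can be explained, or admits a backjump. -/
theorem exists_explain_or_backjump {F₀ : Finset (Clause Sg)} {s : State Sg} (h : Invariant F₀ s)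
    {c : Clause Sg} (hC : s.C = .clause c) (hne : c.Nonempty) :
    (∃ i s', Explain i s s') ∨ ∃ s₁ s', LearnSat s s₁ ∧ Backjump s₁ s' := by
  by_cases hex : ∃ i s', Explain i s s'
  · exact Or.inl hex
  right
  -- A literal of `M` that is not a decision has a reason, which would permit Explain; so the
  -- complement of each literal of `c` directly follows a decision point.
  have hsplit : ∀ x : c, ∃ A R, s.M = A ++ .dec :: .lit x.1.compl :: R := by
    rintro ⟨x, hx⟩
    obtain ⟨M₁, M₂, hM⟩ := exists_split_of_mem_lits (h.conf_falsified c hC x hx)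
    obtain ⟨-, -, -, ⟨A, rfl⟩ | ⟨ls, i, hls, he⟩⟩ := h.entries _ _ _ hM
    · exact ⟨A, M₂, by simpa using hM⟩
    · refine absurd ⟨i, _, x, c.erase x, ls.image Literal.compl, Finset.notMem_erase _ _, ?_, ?_,
        fun y hy => ?_, rfl⟩ hex
      · rw [Finset.insert_erase hx, hC]
      · rwa [image_compl_image_compl]
      · obtain ⟨N₁, N₂, rfl⟩ := exists_split_of_mem_lits (hls _ (mem_image_compl.1 hy))
        exact ⟨N₁, N₂, M₂, by simpa using hM⟩
  choose A R hAR using hsplit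
  have hlev : ∀ x : c, HasLev s.M x.1.compl (numDec (A x) + 1) := fun x =>
    ⟨A x ++ [.dec], R x, by simpa using hAR x, by simp [numDec]⟩
  have : Nonempty c := hne.to_subtype
  -- Levels have only one decision each, so the literal of highest level is alone there, and
  -- Backjump can go to the level just below it.
  obtain ⟨x, hx⟩ := Finite.exists_max fun x : c => numDec (A x)
  refine ⟨_, _, ⟨c, hC, by rw [hAR x]; simp, rfl⟩, x.1, c.erase x.1, numDec (A x),
    Finset.notMem_erase _ _, ?_, fun y hy => ?_, ⟨_, Nat.lt_succ_self _, hlev x⟩, rfl⟩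
  · rw [Finset.insert_erase x.2, ← hC]
  · obtain ⟨hyx, hyc⟩ := Finset.mem_erase.1 hy
    refine ⟨_, ?_, hlev ⟨y, hyc⟩⟩
    refine Nat.succ_le_of_lt (lt_of_le_of_ne (hx ⟨y, hyc⟩) fun heq => hyx ?_)
    have := (append_dec_inj ((hAR ⟨y, hyc⟩).symm.trans (hAR x)) heq).2
    simp only [List.cons.injEq, Entry.lit.injEq] at this
    exact Literal.compl_injective this.1

theorem exists_step_conflict {F₀ : Finset (Clause Sg)} {s : State Sg} (h : Invariant F₀ s)
    (hC : s.C ≠ .bot) : ∃ c', Step F₀ ⟨.conflict, s⟩ c' := by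
  match hC' : s.C with
  | .no => exact ⟨_, .noConflict s hC'⟩
  | .bot => exact absurd hC' hC
  | .clause c =>
    rcases c.eq_empty_or_nonempty with rfl | hne
    · exact ⟨_, .fail s hC'⟩
    · rcases exists_explain_or_backjump h hC' hne with ⟨i, s', h'⟩ | ⟨s₁, s', h₁, h₂⟩
      · exact ⟨_, .explain i s s' h'⟩
      · exact ⟨_, .learnBackjump s s₁ s' h₁ h₂⟩

/-- If both effort checks return `true`, the assignment is FCC-satisfiable. -/
theorem fccSat_lits {s : State Sg} (hw : WeakTrue s) (ht : StrongTrue s) :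
    FCCSat s.M.lits := by
  have hsat : ¬ EUFUnsat s.M.lits := fun hu => hw.1 (.of_eufUnsat hu)
  rcases ht with hcard | ⟨k, n, t, hk, ht, hle⟩
  · exact fccSat_of_no_card (finite_lits _) hsat hcard
  · refine fccSat_of_isReps hsat hk (fun j hj => ?_) ht hle
    by_contra! hlt
    exact hw.2.1 ⟨k, j, hk.1, hj, hlt⟩

theorem propEntails_lits {F₀ : Finset (Clause Sg)} {s : State Sg} (h : Invariant F₀ s)
    (hC : s.C = .no) (ha : AllAssigned s) (hn : ∀ ls s', ¬ Conflict .sat ls s s') :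
    PropEntails s.M.lits F₀ := by
  intro c hc v hv
  obtain ⟨l, hl, hlM⟩ := exists_mem_lits hC ha hn (h.input_subset hc)
  exact ⟨l, hl, hv l hlM⟩

theorem complete (F₀ : Finset (Clause Sg)) : Complete F₀ := by
  rintro ⟨loc, s⟩ hr hstuck
  have h := hr.configInvariant
  cases loc with
  | check =>
    obtain ⟨c', hc'⟩ := exists_step_check h.state (h.no_of_check rfl)
    exact absurd hc' (hstuck c')
  | conflict =>
    obtain ⟨c', hc'⟩ := exists_step_conflict h.state (h.ne_bot_of_conflict rfl)
    exact absurd hc' (hstuck c')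
  | returned =>
    refine ⟨rfl, (h.of_returned rfl).imp_right ?_⟩
    rintro ⟨hC, hw, ha, hn, ht⟩
    exact ⟨hC, fccSat_lits hw ht, propEntails_lits h.state hC ha hn⟩

end FCC

theorem mainTheorem1 {Sg : FCC.Signature.{u}} (F₀ : Finset (FCC.Clause Sg)) :
    FCC.Sound F₀ ∧ FCC.Complete F₀ ∧ FCC.Terminating F₀ :=
  ⟨FCC.sound F₀, FCC.complete F₀, FCC.terminating F₀⟩
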